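/- **Setting.** Let $X=\prod_{i=1}^d[0,u_i]$ and let $C\subseteq X$ be nonempty, compact and convex; put $K=\mathrm{conv}(C\cup\{0\})$ (so $K=C$ if $0\in C$), assume that $K$ has nonempty interior, and let $D$ be the diameter of $K$. For $x\in X$ let $p(\cdot;x)$ be a probability density with respect to a fixed $\sigma$-finite measure on a space $Z$, let $\tilde F(x;z)$ be real valued ($p$ and $\tilde F$ jointly measurable), and let $$F(x)=\mathbb E_{z\sim p(\cdot;x)}[\tilde F(x;z)],\qquad x\in X,$$ be well defined. Assume that $F(0)\ge 0$ and that $F$ is monotone ($x\le y\Rightarrow F(x)\le F(y)$) and DR-submodular on $X$: $F(y+ke_i)-F(y)\le F(x+ke_i)-F(x)$ whenever $x\le y$, $k\ge0$ and all four points lie in $X$. Assume that for all $x\in K$ and $z\in Z$: $p(z;x)>0$; $\tilde F(\cdot;z)$ and $p(z;\cdot)$ are twice continuously differentiable in a neighbourhood of $x$; $|\tilde F(x;z)|\le B$; $\|\nabla\tilde F(x;z)\|\le G$; $\mathbb E_{z\sim p(\cdot;x)}\|\nabla\log p(z;x)\|^4\le G^4$; $\|\nabla^2\tilde F(x;z)\|\le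 L$; and $\mathbb E_{z\sim p(\cdot;x)}\|\nabla^2\log p(z;x)\|^2\le L^2$. Put $$\bar L=\sqrt{4B^2G^4+16G^4+4L^2+4B^2L^2},\qquad \kappa=\frac{(1+B)^2G^2}{\bar L^2D^2}$$ (with $\kappa=0$ if $\bar LD=0$). **Algorithm (SCG++).** Let $\varepsilon>0$ with $T=1/\varepsilon$ an integer, let $M_0,M\ge1$ be minibatch sizes, and let $g\mapsto v(g)\in\arg\max_{v\in C}\langle v,g\rangle$ be a measurable selection. Start at $x^0=0$ and for $t=0,\dots,T-1$ set $x^{t+1}=x^t+\frac1T v(g^t)$, where * $g^0$ is the average over $M_0$ i.i.d. samples $z\sim p(\cdot;x^0)$ of $\nabla\tilde F(x^0;z)+\tilde F(x^0;z)\nabla\log p(z;x^0)$; * for $t\ge1$, $g^t=g^{t-1}+\tilde\Delta^t$, where $\tilde\Delta^t$ is the average over $M$ pairs $(a,z)$ of the Hessian-vector products $\tilde\nabla^2F(x(a);z)\,(x^t-x^{t-1})$; given the past, the pairs are i.i.d. with $a$ uniform on $[0,1]$ and $z\sim p(\cdot;x(a))$, $x(a)=(1-a)x^{t-1}+a\,x^t$;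 and $$\tilde\nabla^2F=\tilde F\,\nabla\log p\,\nabla\log p^\top+\nabla\tilde F\,\nabla\log p^\top+\nabla\log p\,\nabla\tilde F^\top+\nabla^2\tilde F+\tilde F\,\nabla^2\log p .$$ Each sample costs one stochastic oracle call (a stochastic gradient for $g^0$, a Hessian-vector product for $\tilde\Delta^t$). **Theorem.** If $M_0\ge\kappa/\varepsilon^2$ and $M\ge1/\varepsilon$, then $x^T\in C$ almost surely, $F(x^T)$ is integrable, and for every $x^*\in C$ (in particular for a maximizer of $F$ over $C$) $$\mathbb E[F(x^T)]\ \ge\ (1-1/e)\,F(x^*)-2\bar L\,\varepsilon D^2 ,$$ and the run makes exactly $M_0+(T-1)M$ stochastic oracle calls. If moreover $M_0\le\kappa/\varepsilon^2+1$ and $M\le1/\varepsilon+1$, this number is at most $(\kappa+1)/\varepsilon^2=O(1/\varepsilon^2)$. **Finite differences.** Suppose in addition that, for some $r>0$, on the open $r$-neighbourhood of $K$ and for every $z$ one has $p(z;\cdot)>0$, $\tilde F(\cdot;z)$ and $p(z;\cdot)$ are twice continuously differentiable, and $\nabla^2\tilde F(\cdot;z)$ and $\nabla^2\log p(z;\cdot)$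 are $L_2$-Lipschitz. Let $\delta>0$ satisfy $\delta\varepsilon D<r$ and $12(1+B)L_2D\,\delta\le\bar L$. Then, for $M_0\ge\kappa/\varepsilon^2$ and $M\ge1/\varepsilon$, the same conclusions (feasibility, integrability and the bound) hold when, with $u=x^t-x^{t-1}$, the products $\nabla^2\psi(x(a))u$ for $\psi=\tilde F(\cdot;z)$ and $\psi=\log p(z;\cdot)$ are replaced by $\frac{1}{2\delta}\big(\nabla\psi(x(a)+\delta u)-\nabla\psi(x(a)-\delta u)\big)$. Each such sample then costs three gradient calls, so the run makes exactly $M_0+3(T-1)M$ calls, which is at most $(\kappa+3)/\varepsilon^2$ if $M_0\le\kappa/\varepsilon^2+1$ and $M\le1/\varepsilon+1$. -/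

import Mathlib

open MeasureTheory

noncomputable section

namespace SCGpp

/-- Decision space: `ℝ^d` with the Euclidean norm. -/
abbrev Space (d : ℕ) := EuclideanSpace ℝ (Fin d)

/-- The Hessian of `f` at `x`, as a linear operator (its operator norm is the spectral norm). -/
def hessian {d : ℕ} (f : Space d → ℝ) (x : Space d) : Space d →L[ℝ] Space d :=
  fderiv ℝ (gradient f) x

/-- Data of a non-oblivious stochastic objective: the stochastic function `val x z = F̃(x; z)` and
the density `dens x z = p(z; x)` of the sampling law with respect to a reference measure. -/
structure StochObjective (d : ℕ) (Z : Type*) [MeasurableSpace Z] where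
  base : Measure Z
  val : Space d → Z → ℝ
  dens : Space d → Z → ℝ

namespace StochObjective

variable {d : ℕ} {Z : Type*} [MeasurableSpace Z]

/-- The sampling law `p(·; x)`. -/
def sampleLaw (O : StochObjective d Z) (x : Space d) : Measure Z :=
  O.base.withDensity (fun z => ENNReal.ofReal (O.dens x z))

/-- The objective `F(x) = E_{z ∼ p(·; x)} F̃(x; z)`. -/
def objective (O : StochObjective d Z) (x : Space d) : ℝ :=
  ∫ z, O.val x z ∂(O.sampleLaw x)

/-- `∇F̃(x; z)`. -/
def gradVal (O : StochObjective d Z) (x : Space d) (z : Z) : Space d :=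
  gradient (fun y => O.val y z) x

/-- `∇²F̃(x; z)`. -/
def hessVal (O : StochObjective d Z) (x : Space d) (z : Z) : Space d →L[ℝ] Space d :=
  hessian (fun y => O.val y z) x

/-- The score `∇ log p(z; x)`. -/
def score (O : StochObjective d Z) (x : Space d) (z : Z) : Space d :=
  gradient (fun y => Real.log (O.dens y z)) x

/-- `∇² log p(z; x)`. -/
def hessLog (O : StochObjective d Z) (x : Space d) (z : Z) : Space d →L[ℝ] Space d :=
  hessian (fun y => Real.log (O.dens y z)) x

/-- Single-sample stochastic gradient of `F` at `x` for `z ∼ p(·; x)`: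
`∇F̃(x; z) + F̃(x; z) ∇ log p(z; x)`. -/
def gradEst (O : StochObjective d Z) (x : Space d) (z : Z) : Space d :=
  O.gradVal x z + O.val x z • O.score x z

/-- The part of the Hessian estimator that needs first-order information only, applied to `u`:
`F̃ ∇log p ∇log pᵀ u + ∇F̃ ∇log pᵀ u + ∇log p ∇F̃ᵀ u`. -/
def firstOrderPart (O : StochObjective d Z) (y : Space d) (z : Z) (u : Space d) : Space d :=
  (O.val y z * inner ℝ (O.score y z) u) • O.score y z
    + (inner ℝ (O.score y z) u) • O.gradVal y z
    + (inner ℝ (O.gradVal y z) u) • O.score y z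

/-- Product of the stochastic Hessian with `u`:
`[F̃ ∇log p ∇log pᵀ + ∇F̃ ∇log pᵀ + ∇log p ∇F̃ᵀ + ∇²F̃ + F̃ ∇²log p] u`, all at `(y; z)`. -/
def hessVec (O : StochObjective d Z) (y : Space d) (z : Z) (u : Space d) : Space d :=
  O.firstOrderPart y z u + O.hessVal y z u + O.val y z • O.hessLog y z u

/-- The same product with `∇²F̃ u` and `∇²log p u` replaced by central differences of gradients,
`(∇ψ(y + δu) - ∇ψ(y - δu)) / (2δ)`. -/
def hessVecDiff (O : StochObjective d Z) (δ : ℝ) (y : Space d) (z : Z) (u : Space d) : Space d :=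
  O.firstOrderPart y z u
    + (1 / (2 * δ)) • (O.gradVal (y + δ • u) z - O.gradVal (y - δ • u) z)
    + O.val y z • ((1 / (2 * δ)) • (O.score (y + δ • u) z - O.score (y - δ • u) z))

/-- The law of a pair `(a, z)`: `a` uniform on `[0,1]`, then `z ∼ p(·; x(a))` where
`x(a) = (1 - a) x + a x'`. -/
def pathLaw (O : StochObjective d Z) (x x' : Space d) : Measure (ℝ × Z) :=
  (volume.restrict (Set.Icc (0 : ℝ) 1)).bind
    (fun a => (O.sampleLaw ((1 - a) • x + a • x')).map (fun z => (a, z)))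

end StochObjective

/-! ### The algorithm -/

/-- State before iteration `t`: the iterates `x^{t-1}` and `x^t`, the gradient estimate `g^{t-1}`,
and the number of stochastic oracle calls made so far. (At `t = 0` only `x^0 = 0` is used.) -/
abbrev State (d : ℕ) := Space d × Space d × Space d × ℕ

namespace State

variable {d : ℕ}

def prev (s : State d) : Space d := s.1
def cur (s : State d) : Space d := s.2.1
def grad (s : State d) : Space d := s.2.2.1
def calls (s : State d) : ℕ := s.2.2.2

end State

/-- Average of the answers of an oracle over a minibatch, paired with the number of calls made:
one evaluation on a sample costs `cost` calls. -/
def minibatch {d m : ℕ} {S : Type*} (oracle : S → Space d) (cost : ℕ) (b : Fin m → S) :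
    Space d × ℕ :=
  let r : Space d × ℕ := ∑ k, (oracle (b k), cost)
  ((1 / (m : ℝ)) • r.1, r.2)

/-- The end of an iteration: given the new estimate `g^t` and the new call count, move to
`x^{t+1} = x^t + (1/T) v^t` with `v^t` the answer of the linear oracle at `g^t`. -/
def move {d : ℕ} (lmo : Space d → Space d) (T : ℕ) (s : State d) (g : Space d) (calls : ℕ) :
    State d :=
  (s.cur, s.cur + (1 / (T : ℝ)) • lmo g, g, calls)

/-- Law of the state after iteration `t`, given the state `s` before it.  At `t = 0` the estimate
is the average of `M₀` stochastic gradients at `x^0`.  At `t ≥ 1`, draw `M` i.i.d. pairs `(a, z)`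
from the path between `x^{t-1}` and `x^t` and add to `g^{t-1}` the average of the (exact or
approximate) products `hv x(a) z (x^t - x^{t-1})` of stochastic Hessians with `x^t - x^{t-1}`. -/
def iteration {d : ℕ} {Z : Type*} [MeasurableSpace Z] (O : StochObjective d Z)
    (hv : Space d → Z → Space d → Space d) (cost : ℕ) (lmo : Space d → Space d)
    (T M₀ M : ℕ) (t : ℕ) (s : State d) : Measure (State d) :=
  if t = 0 then
    (Measure.pi (fun _ : Fin M₀ => O.sampleLaw s.cur)).map (fun b =>
      let r := minibatch (fun z => O.gradEst s.cur z) 1 b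
      move lmo T s r.1 (s.calls + r.2))
  else
    (Measure.pi (fun _ : Fin M => O.pathLaw s.prev s.cur)).map (fun b =>
      let r := minibatch (fun q : ℝ × Z =>
        hv ((1 - q.1) • s.prev + q.1 • s.cur) q.2 (s.cur - s.prev)) cost b
      move lmo T s (s.grad + r.1) (s.calls + r.2))

/-- Law of the state before iteration `t` of SCG++, started at `x^0 = 0`. The output of a run of
`T` iterations is the component `x^T` of the state under `runLaw … T`. -/
def runLaw {d : ℕ} {Z : Type*} [MeasurableSpace Z] (O : StochObjective d Z)
    (hv : Space d → Z → Space d → Space d) (cost : ℕ) (lmo : Space d → Space d)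
    (T M₀ M : ℕ) : ℕ → Measure (State d)
  | 0 => Measure.dirac (0, 0, 0, 0)
  | t + 1 => (runLaw O hv cost lmo T M₀ M t).bind (iteration O hv cost lmo T M₀ M t)

/-- `lmo` is a (measurable) choice of a maximizer `v ∈ C` of `⟨v, g⟩`. -/
structure IsLinearOracle {d : ℕ} (C : Set (Space d)) (lmo : Space d → Space d) : Prop where
  measurable : Measurable lmo
  mem : ∀ g, lmo g ∈ C
  isMax : ∀ g, IsMaxOn (fun v => inner ℝ v g) C (lmo g)

/-! ### Assumptions -/

/-- The box `∏ [0, u i]`. -/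
def box {d : ℕ} (u : Fin d → ℝ) : Set (Space d) := {x | ∀ i, 0 ≤ x i ∧ x i ≤ u i}

/-- `F` is nondecreasing on `X` for the coordinatewise order. -/
def IsMonotoneOn {d : ℕ} (F : Space d → ℝ) (X : Set (Space d)) : Prop :=
  ∀ x ∈ X, ∀ y ∈ X, (∀ i, x i ≤ y i) → F x ≤ F y

/-- `F` is DR-submodular on `X`: diminishing returns along every coordinate. -/
def IsDRSubmodularOn {d : ℕ} (F : Space d → ℝ) (X : Set (Space d)) : Prop :=
  ∀ x ∈ X, ∀ y ∈ X, (∀ i, x i ≤ y i) → ∀ (i : Fin d) (k : ℝ), 0 ≤ k →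
    x + EuclideanSpace.single i k ∈ X → y + EuclideanSpace.single i k ∈ X →
      F (y + EuclideanSpace.single i k) - F y ≤ F (x + EuclideanSpace.single i k) - F x

/-- `conv(C ∪ {0})`, which contains all iterates started at `0`; it is `C` when `0 ∈ C` and `C` is
convex. -/
def hull0 {d : ℕ} (C : Set (Space d)) : Set (Space d) := convexHull ℝ (insert 0 C)

/-- The diameter `D`. -/
def diameter {d : ℕ} (C : Set (Space d)) : ℝ := Metric.diam (hull0 C)

namespace StochObjective

variable {d : ℕ} {Z : Type*} [MeasurableSpace Z]

/-- The objective is a well-defined expectation at every point of `X`. -/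
structure WellPosedOn (O : StochObjective d Z) (X : Set (Space d)) : Prop where
  measurable_val : Measurable (Function.uncurry O.val)
  measurable_dens : Measurable (Function.uncurry O.dens)
  dens_nonneg : ∀ x ∈ X, ∀ z, 0 ≤ O.dens x z
  isProbability : ∀ x ∈ X, IsProbabilityMeasure (O.sampleLaw x)
  integrable : ∀ x ∈ X, Integrable (O.val x) (O.sampleLaw x)

/-- `F̃(·; z)` and `log p(z; ·)` are twice continuously differentiable around the points of `K`. -/
structure TwiceDiffOn (O : StochObjective d Z) (K : Set (Space d)) : Prop where
  dens_pos : ∀ x ∈ K, ∀ z, 0 < O.dens x z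
  val : ∀ x ∈ K, ∀ z, ContDiffAt ℝ 2 (fun y => O.val y z) x
  dens : ∀ x ∈ K, ∀ z, ContDiffAt ℝ 2 (fun y => O.dens y z) x

/-- Bounded stochastic values, bounded gradients (fourth moment for the score) and bounded second
derivatives (second moment for the log-density). -/
structure BoundedOn (O : StochObjective d Z) (K : Set (Space d)) (B G L : ℝ) : Prop where
  val_le : ∀ x ∈ K, ∀ z, |O.val x z| ≤ B
  gradVal_le : ∀ x ∈ K, ∀ z, ‖O.gradVal x z‖ ≤ G
  score_integrable : ∀ x ∈ K, Integrable (fun z => ‖O.score x z‖ ^ 4) (O.sampleLaw x)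
  score_le : ∀ x ∈ K, ∫ z, ‖O.score x z‖ ^ 4 ∂(O.sampleLaw x) ≤ G ^ 4
  hessVal_le : ∀ x ∈ K, ∀ z, ‖O.hessVal x z‖ ≤ L
  hessLog_integrable : ∀ x ∈ K, Integrable (fun z => ‖O.hessLog x z‖ ^ 2) (O.sampleLaw x)
  hessLog_le : ∀ x ∈ K, ∫ z, ‖O.hessLog x z‖ ^ 2 ∂(O.sampleLaw x) ≤ L ^ 2

/-- `∇²F̃(·; z)` and `∇²log p(z; ·)` are `L₂`-Lipschitz on `K`. -/
structure HessianLipschitzOn (O : StochObjective d Z) (K : Set (Space d)) (L₂ : ℝ) : Prop where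
  val : ∀ x ∈ K, ∀ y ∈ K, ∀ z, ‖O.hessVal x z - O.hessVal y z‖ ≤ L₂ * ‖x - y‖
  log : ∀ x ∈ K, ∀ y ∈ K, ∀ z, ‖O.hessLog x z - O.hessLog y z‖ ≤ L₂ * ‖x - y‖

end StochObjective

/-- `L̄ = (4B²G⁴ + 16G⁴ + 4L² + 4B²L²)^{1/2}`. -/
def Lbar (B G L : ℝ) : ℝ :=
  Real.sqrt (4 * B ^ 2 * G ^ 4 + 16 * G ^ 4 + 4 * L ^ 2 + 4 * B ^ 2 * L ^ 2)

/-- The constant `κ = (1 + B)²G² / (L̄²D²)`; the initial minibatch has size about `κ/ε²`. -/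
def batchConst (B G L D : ℝ) : ℝ := ((1 + B) ^ 2 * G ^ 2) / (Lbar B G L ^ 2 * D ^ 2)

/-- A law `ν` of final states is a successful run: the output lies in `C`, its expected value
exists and is at least `(1 - 1/e) F(x⋆) - 2 L̄ ε D²` for every `x⋆ ∈ C` (in particular for a
maximizer), and exactly `n` oracle calls are made. -/
structure Succeeds {d : ℕ} (F : Space d → ℝ) (C : Set (Space d)) (ν : Measure (State d))
    (Lb ε : ℝ) (n : ℕ) : Prop where
  isProbability : IsProbabilityMeasure ν
  feasible : ∀ᵐ s ∂ν, s.cur ∈ C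
  integrable : Integrable (fun s : State d => F s.cur) ν
  guarantee : ∀ xstar ∈ C,
    ∫ s : State d, F s.cur ∂ν ≥ (1 - 1 / Real.exp 1) * F xstar - 2 * Lb * ε * diameter C ^ 2
  calls_eq : ∀ᵐ s ∂ν, s.calls = n

end SCGpp

end

noncomputable section

namespace SCGpp

/-! ### Geometry of `conv(C ∪ {0})` -/

section Hull

variable {d : ℕ} {C : Set (Space d)}

lemma zero_mem_hull0 : (0 : Space d) ∈ hull0 C :=
  subset_convexHull ℝ _ (Set.mem_insert _ _)

lemma subset_hull0 : C ⊆ hull0 C :=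
  (Set.subset_insert _ _).trans (subset_convexHull ℝ _)

lemma convex_hull0 : Convex ℝ (hull0 C) := convex_convexHull ℝ _

lemma hull0_eq_image (hC : Convex ℝ C) (hne : C.Nonempty) :
    hull0 C = (fun p : ℝ × Space d => p.1 • p.2) '' (Set.Icc (0 : ℝ) 1 ×ˢ C) := by
  rw [hull0, convexHull_insert hne, hC.convexHull_eq]
  ext x
  simp only [mem_convexJoin, Set.mem_singleton_iff, exists_eq_left, Set.mem_image, Set.mem_prod,
    Prod.exists]
  constructor
  · rintro ⟨c, hc, a, b, ha, hb, hab, rfl⟩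
    exact ⟨b, c, ⟨⟨hb, by linarith⟩, hc⟩, by simp⟩
  · rintro ⟨b, c, ⟨⟨hb, hb1⟩, hc⟩, rfl⟩
    exact ⟨c, hc, 1 - b, b, by linarith, hb, by ring, by simp⟩

lemma isCompact_hull0 (hC : Convex ℝ C) (hcomp : IsCompact C) (hne : C.Nonempty) :
    IsCompact (hull0 C) := by
  rw [hull0_eq_image hC hne]
  exact (isCompact_Icc.prod hcomp).image (by fun_prop)

lemma smul_mem_hull0 {a : ℝ} (h0 : 0 ≤ a) (h1 : a ≤ 1) {c : Space d} (hc : c ∈ C) :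
    a • c ∈ hull0 C :=
  convex_hull0.smul_mem_of_zero_mem zero_mem_hull0 (subset_hull0 hc) ⟨h0, h1⟩

lemma convex_box (u : Fin d → ℝ) : Convex ℝ (box u) := by
  intro x hx y hy a b ha hb hab i
  simp only [PiLp.add_apply, PiLp.smul_apply, smul_eq_mul]
  refine ⟨add_nonneg (mul_nonneg ha (hx i).1) (mul_nonneg hb (hy i).1), ?_⟩
  calc a * x i + b * y i ≤ a * u i + b * u i :=
        add_le_add (mul_le_mul_of_nonneg_left (hx i).2 ha) (mul_le_mul_of_nonneg_left (hy i).2 hb)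
    _ = u i := by rw [← add_mul, hab, one_mul]

lemma hull0_subset_box {u : Fin d → ℝ} (hne : C.Nonempty) (hbox : C ⊆ box u) :
    hull0 C ⊆ box u := by
  refine convexHull_min (Set.insert_subset ?_ hbox) (convex_box u)
  obtain ⟨c, hc⟩ := hne
  exact fun i => ⟨le_rfl, (hbox hc i).1.trans (hbox hc i).2⟩

lemma norm_sub_le_diameter (hcomp : IsCompact (hull0 C)) {x y : Space d} (hx : x ∈ hull0 C)
    (hy : y ∈ hull0 C) : ‖x - y‖ ≤ diameter C := by
  rw [← dist_eq_norm]
  exact Metric.dist_le_diam_of_mem hcomp.isBounded hx hy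

lemma norm_le_diameter (hcomp : IsCompact (hull0 C)) {x : Space d} (hx : x ∈ hull0 C) :
    ‖x‖ ≤ diameter C := by
  simpa using norm_sub_le_diameter hcomp hx zero_mem_hull0

lemma segment_mem {K : Set (Space d)} (hK : Convex ℝ K) {x y : Space d} (hx : x ∈ K) (hy : y ∈ K)
    {a : ℝ} (ha : a ∈ Set.Icc (0 : ℝ) 1) : (1 - a) • x + a • y ∈ K :=
  hK hx hy (by linarith [ha.2]) ha.1 (by ring)

end Hull

/-! ### First-order consequences of monotonicity and DR-submodularity -/

section DR

variable {d : ℕ} {F : Space d → ℝ} {u : Fin d → ℝ}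

lemma IsDRSubmodularOn.increment_le (h : IsDRSubmodularOn F (box u)) {x y w : Space d}
    (hx : x ∈ box u) (hxy : ∀ i, x i ≤ y i) (hw : ∀ i, 0 ≤ w i) (hyw : y + w ∈ box u) :
    F (y + w) - F y ≤ F (x + w) - F x := by
  classical
  have key : ∀ s : Finset (Fin d),
      F (y + ∑ i ∈ s, EuclideanSpace.single i (w i)) - F y
        ≤ F (x + ∑ i ∈ s, EuclideanSpace.single i (w i)) - F x := by
    have hsum : ∀ (s : Finset (Fin d)) (j : Fin d),
        (∑ i ∈ s, EuclideanSpace.single i (w i) : Space d) j = if j ∈ s then w j else 0 := by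
      intro s j
      simp [Pi.single_apply]
    have hbox : ∀ (s : Finset (Fin d)) (z : Space d), (∀ i, 0 ≤ z i) → (∀ i, z i ≤ y i) →
        z + ∑ i ∈ s, EuclideanSpace.single i (w i) ∈ box u := by
      intro s z hz hzy j
      have h1 := hyw j
      have h2 := hw j
      have h3 := hz j
      have h4 := hzy j
      rw [PiLp.add_apply, hsum]
      rw [PiLp.add_apply] at h1
      split_ifs <;> constructor <;> linarith
    have hx0 : ∀ i, 0 ≤ x i := fun i => (hx i).1
    have hy0 : ∀ i, 0 ≤ y i := fun i => (hx0 i).trans (hxy i)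
    intro s
    induction s using Finset.induction_on with
    | empty => simp
    | insert a s ha ih =>
      have hins : ∀ z : Space d, z + ∑ i ∈ insert a s, EuclideanSpace.single i (w i)
          = z + ∑ i ∈ s, EuclideanSpace.single i (w i) + EuclideanSpace.single a (w a) := by
        intro z
        rw [Finset.sum_insert ha]
        abel
      have := h _ (hbox s x hx0 hxy) _ (hbox s y hy0 fun _ => le_rfl)
        (fun i => by simp only [PiLp.add_apply]; linarith [hxy i]) a (w a) (hw a)
        (by rw [← hins]; exact hbox _ x hx0 hxy) (by rw [← hins]; exact hbox _ y hy0 fun _ => le_rfl)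
      rw [hins, hins]
      linarith
  have hwsum : ∑ i, EuclideanSpace.single i (w i) = w := by
    ext j
    simp [Pi.single_apply]
  simpa [hwsum] using key Finset.univ

lemma IsDRSubmodularOn.increment_le_nsmul (h : IsDRSubmodularOn F (box u)) {x w : Space d}
    (hx : x ∈ box u) (hw : ∀ i, 0 ≤ w i) (hxw : x + w ∈ box u) {n : ℕ} (hn : 0 < n) :
    F (x + w) - F x ≤ n * (F (x + (1 / (n : ℝ)) • w) - F x) := by
  have hn' : (0 : ℝ) < n := by exact_mod_cast hn
  have key : ∀ j : ℕ, j ≤ n →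
      F (x + (j / (n : ℝ)) • w) - F x ≤ j * (F (x + (1 / (n : ℝ)) • w) - F x) := by
    intro j
    induction j with
    | zero => simp
    | succ j ih =>
      intro hj
      have hsplit : x + (((j + 1 : ℕ) : ℝ) / n) • w
          = (x + (j / (n : ℝ)) • w) + (1 / (n : ℝ)) • w := by
        rw [add_assoc, ← add_smul]
        congr 2
        push_cast
        ring
      have hle : ((j + 1 : ℕ) : ℝ) / n ≤ 1 := by
        rw [div_le_one hn']
        exact_mod_cast hj
      have hmem : (x + (j / (n : ℝ)) • w) + (1 / (n : ℝ)) • w ∈ box u := by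
        rw [← hsplit]
        have := (convex_box u).add_smul_mem hx hxw (t := ((j + 1 : ℕ) : ℝ) / n)
          ⟨by positivity, hle⟩
        exact this
      have h1 := h.increment_le (y := x + (j / (n : ℝ)) • w) (w := (1 / (n : ℝ)) • w) hx
        (fun i => by
          simp only [PiLp.add_apply, PiLp.smul_apply, smul_eq_mul]
          have := mul_nonneg (show 0 ≤ (j : ℝ) / n by positivity) (hw i)
          linarith)
        (fun i => by
          simp only [PiLp.smul_apply, smul_eq_mul]
          exact mul_nonneg (by positivity) (hw i)) hmem
      have h2 := ih (by omega)
      rw [hsplit]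
      push_cast
      linarith
  have := key n le_rfl
  rwa [div_self hn'.ne', one_smul] at this

/-- `φ` is a Lipschitz gradient of `F` on `K`, in quadratic-error form. -/
structure SmoothOn (F : Space d → ℝ) (φ : Space d → Space d) (K : Set (Space d)) (Λ : ℝ) :
    Prop where
  taylor : ∀ x ∈ K, ∀ y ∈ K, |F y - F x - inner ℝ (φ x) (y - x)| ≤ Λ / 2 * ‖y - x‖ ^ 2
  lipschitz : ∀ x ∈ K, ∀ y ∈ K, ‖φ y - φ x‖ ≤ Λ * ‖y - x‖

variable {φ : Space d → Space d} {K : Set (Space d)} {Λ : ℝ}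

open Filter Topology in
lemma eventually_add_smul_mem {x : Space d} (hx : x ∈ interior K) (w : Space d) :
    ∀ᶠ n : ℕ in atTop, x + (1 / (n : ℝ)) • w ∈ K := by
  have : Tendsto (fun n : ℕ => x + (1 / (n : ℝ)) • w) atTop (𝓝 (x + (0 : ℝ) • w)) :=
    tendsto_const_nhds.add (tendsto_one_div_atTop_nhds_zero_nat.smul_const w)
  rw [zero_smul, add_zero] at this
  exact this.eventually (mem_interior_iff_mem_nhds.1 hx)

open Filter Topology in
lemma SmoothOn.tendsto_slope (h : SmoothOn F φ K Λ) {x : Space d} (hx : x ∈ interior K)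
    (w : Space d) :
    Tendsto (fun n : ℕ => n * (F (x + (1 / (n : ℝ)) • w) - F x)) atTop
      (𝓝 (inner ℝ (φ x) w)) := by
  rw [tendsto_iff_norm_sub_tendsto_zero]
  have hlim : Tendsto (fun n : ℕ => (Λ / 2 * ‖w‖ ^ 2) * (1 / (n : ℝ))) atTop (𝓝 0) := by
    simpa only [mul_zero] using
      (tendsto_one_div_atTop_nhds_zero_nat (𝕜 := ℝ)).const_mul (Λ / 2 * ‖w‖ ^ 2)
  refine squeeze_zero' (Eventually.of_forall fun _ => norm_nonneg _) ?_ hlim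
  filter_upwards [eventually_add_smul_mem hx w, eventually_gt_atTop 0] with n hn hpos
  have hpos' : (0 : ℝ) < n := by exact_mod_cast hpos
  have h1 := h.taylor x (interior_subset hx) _ hn
  rw [add_sub_cancel_left, inner_smul_right, norm_smul, mul_pow] at h1
  have h2 : (n : ℝ) * (F (x + (1 / (n : ℝ)) • w) - F x) - inner ℝ (φ x) w
      = n * (F (x + (1 / (n : ℝ)) • w) - F x - 1 / n * inner ℝ (φ x) w) := by
    field_simp
  rw [h2, Real.norm_eq_abs, abs_mul, abs_of_pos hpos']
  refine (mul_le_mul_of_nonneg_left h1 hpos'.le).trans (le_of_eq ?_)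
  rw [Real.norm_of_nonneg (by positivity)]
  field_simp

open Filter Topology in
lemma SmoothOn.apply_sub_le_inner_of_mem_interior (h : SmoothOn F φ K Λ) (hK : K ⊆ box u)
    (hmono : IsMonotoneOn F (box u)) (hDR : IsDRSubmodularOn F (box u)) {x y : Space d}
    (hx : x ∈ interior K) (hy : y ∈ box u) : F y - F x ≤ inner ℝ (φ x) y := by
  have hxb : x ∈ box u := hK (interior_subset hx)
  have hφ : ∀ w : Space d, (∀ i, 0 ≤ w i) → 0 ≤ inner ℝ (φ x) w := by
    intro w hw
    refine ge_of_tendsto (h.tendsto_slope hx w) ?_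
    filter_upwards [eventually_add_smul_mem hx w] with n hn
    refine mul_nonneg (by positivity) (sub_nonneg.2 (hmono _ hxb _ (hK hn) fun i => ?_))
    simp only [PiLp.add_apply, PiLp.smul_apply, smul_eq_mul]
    have := mul_nonneg (show 0 ≤ 1 / (n : ℝ) by positivity) (hw i)
    linarith
  have hDR' : ∀ w : Space d, (∀ i, 0 ≤ w i) → x + w ∈ box u → F (x + w) - F x ≤ inner ℝ (φ x) w := by
    intro w hw hxw
    refine ge_of_tendsto (h.tendsto_slope hx w) ?_
    filter_upwards [eventually_gt_atTop 0] with n hn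
    exact hDR.increment_le_nsmul hxb hw hxw hn
  set w : Space d := WithLp.toLp 2 fun i => max (x i) (y i) - x i with hwdef
  have hwi : ∀ i, w i = max (x i) (y i) - x i := fun i => rfl
  have hxw : ∀ i, (x + w) i = max (x i) (y i) := fun i => by
    rw [PiLp.add_apply, hwi]; ring
  have hxwb : x + w ∈ box u := fun i => by
    rw [hxw]
    exact ⟨(hxb i).1.trans (le_max_left _ _), max_le (hxb i).2 (hy i).2⟩
  have h1 := hDR' w (fun i => by rw [hwi]; linarith [le_max_left (x i) (y i)]) hxwb
  have h2 := hmono _ hy _ hxwb fun i => by rw [hxw]; exact le_max_right _ _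
  have h3 := hφ (y - w) fun i => by
    rw [PiLp.sub_apply, hwi]
    have := (hxb i).1
    have := (hy i).1
    rcases max_cases (x i) (y i) with ⟨h, _⟩ | ⟨h, _⟩ <;> rw [h] <;> linarith
  rw [inner_sub_right] at h3
  linarith

lemma SmoothOn.continuousOn_grad (h : SmoothOn F φ K Λ) : ContinuousOn φ K := by
  have : LipschitzOnWith (Real.toNNReal Λ) φ K := by
    refine LipschitzOnWith.of_dist_le_mul fun x hx y hy => ?_
    rw [dist_eq_norm, dist_eq_norm]
    exact (h.lipschitz y hy x hx).trans
      (mul_le_mul_of_nonneg_right (Real.le_coe_toNNReal Λ) (norm_nonneg _))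
  exact this.continuousOn

open Filter Topology in
lemma SmoothOn.continuousOn (h : SmoothOn F φ K Λ) : ContinuousOn F K := by
  intro x hx
  rw [ContinuousWithinAt, tendsto_iff_norm_sub_tendsto_zero]
  have hlim : Tendsto (fun y => |inner ℝ (φ x) (y - x)| + Λ / 2 * ‖y - x‖ ^ 2) (𝓝[K] x) (𝓝 0) := by
    have : Continuous fun y => |inner ℝ (φ x) (y - x)| + Λ / 2 * ‖y - x‖ ^ 2 := by fun_prop
    have := (this.tendsto x).mono_left (nhdsWithin_le_nhds (s := K))
    simpa using this
  refine squeeze_zero' (Eventually.of_forall fun _ => norm_nonneg _) ?_ hlim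
  filter_upwards [self_mem_nhdsWithin] with y hy
  have := h.taylor x hx y hy
  rw [Real.norm_eq_abs]
  have h2 := abs_add_le (F y - F x - inner ℝ (φ x) (y - x)) (inner ℝ (φ x) (y - x))
  rw [sub_add_cancel] at h2
  linarith

open Filter Topology in
/-- The first-order inequality behind the `1 - 1/e` guarantee, up to the boundary of `K`. -/
lemma SmoothOn.apply_sub_le_inner (h : SmoothOn F φ K Λ) (hK : K ⊆ box u) (hconv : Convex ℝ K)
    (hint : (interior K).Nonempty) (hmono : IsMonotoneOn F (box u))
    (hDR : IsDRSubmodularOn F (box u)) {x y : Space d} (hx : x ∈ K) (hy : y ∈ box u) :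
    F y - F x ≤ inner ℝ (φ x) y := by
  have hcl : x ∈ closure (interior K) := by
    rw [hconv.closure_interior_eq_closure_of_nonempty_interior hint]
    exact subset_closure hx
  have : (𝓝[interior K] x).NeBot := mem_closure_iff_nhdsWithin_neBot.1 hcl
  have hF : Tendsto F (𝓝[interior K] x) (𝓝 (F x)) :=
    (h.continuousOn x hx).mono_left (nhdsWithin_mono _ interior_subset)
  have hφ : Tendsto φ (𝓝[interior K] x) (𝓝 (φ x)) :=
    (h.continuousOn_grad x hx).mono_left (nhdsWithin_mono _ interior_subset)
  refine le_of_tendsto_of_tendsto (tendsto_const_nhds.sub hF)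
    (hφ.inner tendsto_const_nhds) ?_
  filter_upwards [self_mem_nhdsWithin] with z hz
  exact h.apply_sub_le_inner_of_mem_interior hK hmono hDR hz hy

end DR

/-! ### Measurability of parametric derivatives on a convex set -/

section MeasurableDeriv

variable {d : ℕ} {Z : Type*} [MeasurableSpace Z] {K : Set (Space d)}
variable {E : Type*} [NormedAddCommGroup E] [NormedSpace ℝ E] [MeasurableSpace E] [BorelSpace E]
  [SecondCountableTopology E]

open Filter Topology in
lemma measurable_fderiv_sub (hK : Convex ℝ K) {g : Space d → Z → E}
    (hg : Measurable fun p : K × Z => g p.1 p.2)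
    (hd : ∀ x ∈ K, ∀ z, DifferentiableAt ℝ (fun y => g y z) x) {y : Space d} (hy : y ∈ K) :
    Measurable fun p : K × Z => fderiv ℝ (fun x => g x p.2) p.1 (y - p.1) := by
  have hmem : ∀ (n : ℕ) (x : K), (x : Space d) + (1 / ((n : ℝ) + 1)) • (y - x) ∈ K := by
    intro n x
    refine hK.add_smul_sub_mem x.2 hy ⟨by positivity, ?_⟩
    rw [div_le_one (by positivity)]
    linarith [(Nat.cast_nonneg n : (0 : ℝ) ≤ n)]
  let P : ℕ → K → K := fun n x => ⟨x + (1 / ((n : ℝ) + 1)) • (y - x), hmem n x⟩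
  have hP : ∀ n, Measurable (P n) := fun n => by
    refine Measurable.subtype_mk ?_
    have : Continuous fun x : K => (x : Space d) + (1 / ((n : ℝ) + 1)) • (y - x) := by fun_prop
    exact this.measurable
  refine measurable_of_tendsto_metrizable
    (f := fun (n : ℕ) (p : K × Z) => ((n : ℝ) + 1) • (g (P n p.1) p.2 - g p.1 p.2)) (fun n => ?_) ?_
  · have h1 : Measurable fun p : K × Z => g (P n p.1) p.2 :=
      hg.comp (((hP n).comp measurable_fst).prodMk measurable_snd)
    exact (h1.sub hg).const_smul _
  · rw [tendsto_pi_nhds]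
    intro p
    have hfd := (hd p.1 p.1.2 p.2).hasFDerivAt
    have hc : Tendsto (fun n : ℕ => ‖(n : ℝ) + 1‖) atTop atTop := by
      refine tendsto_norm_atTop_atTop.comp ?_
      exact tendsto_atTop_add_const_right _ _ tendsto_natCast_atTop_atTop
    have := hfd.lim (y - (p.1 : Space d)) hc
    simpa only [P, one_div] using this

lemma measurable_fderiv_apply (hK : Convex ℝ K) (hint : (interior K).Nonempty)
    {g : Space d → Z → E} (hg : Measurable fun p : K × Z => g p.1 p.2)
    (hd : ∀ x ∈ K, ∀ z, DifferentiableAt ℝ (fun y => g y z) x) (w : Space d) :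
    Measurable fun p : K × Z => fderiv ℝ (fun x => g x p.2) p.1 w := by
  obtain ⟨c, hc⟩ := hint
  obtain ⟨n, hn, hn0⟩ := ((eventually_add_smul_mem hc w).and
    (Filter.eventually_gt_atTop 0)).exists
  have hn' : (n : ℝ) ≠ 0 := by exact_mod_cast hn0.ne'
  have h1 := measurable_fderiv_sub hK hg hd hn
  have h2 := measurable_fderiv_sub hK hg hd (interior_subset hc)
  convert (h1.sub h2).const_smul (n : ℝ) using 2 with p
  simp only [Pi.smul_apply, Pi.sub_apply]
  rw [← map_sub, ← map_smul]
  congr 1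
  rw [sub_sub_sub_cancel_right, add_sub_cancel_left, smul_smul, mul_one_div_cancel hn', one_smul]

lemma sum_apply_smul_single (w : Space d) :
    ∑ i, w i • EuclideanSpace.single i (1 : ℝ) = w := by
  ext j
  simp [Pi.single_apply]

lemma inner_gradient (f : Space d → ℝ) (x w : Space d) :
    inner ℝ (gradient f x) w = fderiv ℝ f x w := by
  rw [gradient, InnerProductSpace.toDual_symm_apply]

lemma measurable_gradient (hK : Convex ℝ K) (hint : (interior K).Nonempty)
    {g : Space d → Z → ℝ} (hg : Measurable fun p : K × Z => g p.1 p.2)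
    (hd : ∀ x ∈ K, ∀ z, DifferentiableAt ℝ (fun y => g y z) x) :
    Measurable fun p : K × Z => gradient (fun y => g y p.2) (p.1 : Space d) := by
  have : ∀ p : K × Z, gradient (fun y => g y p.2) (p.1 : Space d)
      = ∑ i, (fderiv ℝ (fun y => g y p.2) p.1 (EuclideanSpace.single i (1 : ℝ))) •
        EuclideanSpace.single i (1 : ℝ) := by
    intro p
    conv_lhs => rw [← sum_apply_smul_single (gradient (fun y => g y p.2) (p.1 : Space d))]
    refine Finset.sum_congr rfl fun i _ => ?_
    rw [← inner_gradient, EuclideanSpace.inner_single_right]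
    simp
  simp_rw [this]
  exact Finset.measurable_sum _ fun i _ =>
    (measurable_fderiv_apply hK hint hg hd _).smul_const _

lemma measurable_fderiv_apply_uncurry (hK : Convex ℝ K) (hint : (interior K).Nonempty)
    {g : Space d → Z → E} (hg : Measurable fun p : K × Z => g p.1 p.2)
    (hd : ∀ x ∈ K, ∀ z, DifferentiableAt ℝ (fun y => g y z) x) :
    Measurable fun p : (K × Z) × Space d => fderiv ℝ (fun x => g x p.1.2) p.1.1 p.2 := by
  have : ∀ p : (K × Z) × Space d, fderiv ℝ (fun x => g x p.1.2) p.1.1 p.2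
      = ∑ i, p.2 i • fderiv ℝ (fun x => g x p.1.2) p.1.1 (EuclideanSpace.single i (1 : ℝ)) := by
    intro p
    conv_lhs => rw [← sum_apply_smul_single p.2]
    simp only [map_sum, map_smul]
  simp_rw [this]
  refine Finset.measurable_sum _ fun i _ => Measurable.smul ?_ ?_
  · have : Continuous fun v : Space d => v i := by fun_prop
    exact this.measurable.comp measurable_snd
  · exact (measurable_fderiv_apply hK hint hg hd _).comp measurable_fst

end MeasurableDeriv

namespace StochObjective

variable {d : ℕ} {Z : Type*} [MeasurableSpace Z] {O : StochObjective d Z} {K : Set (Space d)}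

/-! ### Pointwise calculus for the stochastic function and the log-density -/

lemma contDiffAt_gradient {f : Space d → ℝ} {x : Space d} (hf : ContDiffAt ℝ 2 f x) :
    ContDiffAt ℝ 1 (gradient f) x := by
  have h1 : ContDiffAt ℝ 1 (fderiv ℝ f) x := hf.fderiv_right (by norm_num)
  exact ((InnerProductSpace.toDual ℝ (Space d)).symm.toContinuousLinearEquiv.contDiff.contDiffAt).comp
    x h1

lemma hasFDerivAt_gradient {f : Space d → ℝ} {x : Space d} (hf : ContDiffAt ℝ 2 f x) :
    HasFDerivAt (gradient f) (hessian f x) x :=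
  ((contDiffAt_gradient hf).differentiableAt one_ne_zero).hasFDerivAt

namespace TwiceDiffOn

variable (h : O.TwiceDiffOn K) {x : Space d} (hx : x ∈ K) (z : Z)
include h hx

lemma log : ContDiffAt ℝ 2 (fun y => Real.log (O.dens y z)) x :=
  (h.dens x hx z).log (h.dens_pos x hx z).ne'

lemma hasFDerivAt_dens (w : Space d) :
    fderiv ℝ (fun y => O.dens y z) x w = O.dens x z * inner ℝ (O.score x z) w := by
  have hd : DifferentiableAt ℝ (fun y => O.dens y z) x :=
    (h.dens x hx z).differentiableAt two_ne_zero
  have hp := (h.dens_pos x hx z).ne'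
  rw [score, inner_gradient, fderiv.log hd hp]
  simp [hp]

lemma contDiffAt_gradEst : ContDiffAt ℝ 1 (fun y => O.gradEst y z) x :=
  (contDiffAt_gradient (h.val x hx z)).add
    (((h.val x hx z).of_le (by norm_num)).smul (contDiffAt_gradient (h.log hx z)))

lemma fderiv_gradEst (w : Space d) :
    fderiv ℝ (fun y => O.gradEst y z) x w + inner ℝ (O.score x z) w • O.gradEst x z
      = O.hessVec x z w := by
  have h1 : HasFDerivAt (fun y => O.gradVal y z) (O.hessVal x z) x :=
    hasFDerivAt_gradient (h.val x hx z)
  have h2 : HasFDerivAt (fun y => O.score y z) (O.hessLog x z) x :=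
    hasFDerivAt_gradient (h.log hx z)
  have h3 : HasFDerivAt (fun y => O.val y z) (fderiv ℝ (fun y => O.val y z) x) x :=
    ((h.val x hx z).differentiableAt two_ne_zero).hasFDerivAt
  have h4 := (h1.add (h3.smul h2)).fderiv
  have h5 : fderiv ℝ (fun y => O.gradEst y z) x = _ := h4
  rw [h5]
  simp only [add_apply, smul_apply,
    ContinuousLinearMap.smulRight_apply, hessVec, firstOrderPart, gradEst]
  rw [← inner_gradient]
  change _ + (_ + inner ℝ (O.gradVal x z) w • _) + _ = _
  module

end TwiceDiffOn

/-! ### Measurability of the oracles on `K × Z` -/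

section Measurability

variable (hK : Convex ℝ K) (hint : (interior K).Nonempty) (h : O.TwiceDiffOn K)
  (hval : Measurable (Function.uncurry O.val)) (hdens : Measurable (Function.uncurry O.dens))

include hval in
lemma measurable_val_subtype : Measurable fun p : K × Z => O.val p.1 p.2 :=
  hval.comp ((measurable_subtype_coe.comp measurable_fst).prodMk measurable_snd)

include hdens in
lemma measurable_log_dens_subtype : Measurable fun p : K × Z => Real.log (O.dens p.1 p.2) :=
  Real.measurable_log.comp
    (hdens.comp ((measurable_subtype_coe.comp measurable_fst).prodMk measurable_snd))

include hK hint h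

include hval in
lemma measurable_gradVal : Measurable fun p : K × Z => O.gradVal p.1 p.2 :=
  measurable_gradient hK hint (measurable_val_subtype hval)
    fun x hx z => (h.val x hx z).differentiableAt two_ne_zero

include hdens in
lemma measurable_score : Measurable fun p : K × Z => O.score p.1 p.2 :=
  measurable_gradient hK hint (measurable_log_dens_subtype hdens)
    fun _ hx z => (h.log hx z).differentiableAt two_ne_zero

include hval hdens in
lemma measurable_gradEst : Measurable fun p : K × Z => O.gradEst p.1 p.2 :=
  (measurable_gradVal hK hint h hval).add
    ((measurable_val_subtype hval).smul (measurable_score hK hint h hdens))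

include hval in
lemma measurable_hessVal :
    Measurable fun p : (K × Z) × Space d => O.hessVal p.1.1 p.1.2 p.2 :=
  measurable_fderiv_apply_uncurry hK hint (measurable_gradVal hK hint h hval)
    fun x hx z => (hasFDerivAt_gradient (h.val x hx z)).differentiableAt

include hdens in
lemma measurable_hessLog :
    Measurable fun p : (K × Z) × Space d => O.hessLog p.1.1 p.1.2 p.2 :=
  measurable_fderiv_apply_uncurry hK hint (measurable_score hK hint h hdens)
    fun _ hx z => (hasFDerivAt_gradient (h.log hx z)).differentiableAt

include hval hdens

lemma measurable_firstOrderPart :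
    Measurable fun p : (K × Z) × Space d => O.firstOrderPart p.1.1 p.1.2 p.2 := by
  have h1 := (measurable_val_subtype (K := K) hval).comp
    (measurable_fst : Measurable (Prod.fst : (K × Z) × Space d → K × Z))
  have h2 := (measurable_gradVal hK hint h hval).comp
    (measurable_fst : Measurable (Prod.fst : (K × Z) × Space d → K × Z))
  have h3 := (measurable_score hK hint h hdens).comp
    (measurable_fst : Measurable (Prod.fst : (K × Z) × Space d → K × Z))
  have h4 : Measurable fun p : (K × Z) × Space d => inner ℝ (O.score p.1.1 p.1.2) p.2 :=
    h3.inner measurable_snd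
  have h5 : Measurable fun p : (K × Z) × Space d => inner ℝ (O.gradVal p.1.1 p.1.2) p.2 :=
    h2.inner measurable_snd
  exact (((h1.mul h4).smul h3).add (h4.smul h2)).add (h5.smul h3)

lemma measurable_hessVec :
    Measurable fun p : (K × Z) × Space d => O.hessVec p.1.1 p.1.2 p.2 :=
  ((measurable_firstOrderPart hK hint h hval hdens).add (measurable_hessVal hK hint h hval)).add
    (((measurable_val_subtype hval).comp measurable_fst).smul
      (measurable_hessLog hK hint h hdens))

end Measurability


variable {d : ℕ} {Z : Type*} [MeasurableSpace Z] {O : StochObjective d Z} {K : Set (Space d)}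

/-! ### The path law and the score-function identity -/

section PathLaw

lemma measurable_objective (hval : Measurable (Function.uncurry O.val))
    (hdens : Measurable (Function.uncurry O.dens)) [SigmaFinite O.base] :
    Measurable O.objective := by
  have hm : Measurable fun p : Space d × Z => ENNReal.ofReal (O.dens p.1 p.2) :=
    ENNReal.measurable_ofReal.comp hdens
  have h1 : O.objective = fun x => ∫ z, (ENNReal.ofReal (O.dens x z)).toReal • O.val x z ∂O.base := by
    funext x
    exact integral_withDensity_eq_integral_toReal_smul (hm.comp measurable_prodMk_left)
      (Filter.Eventually.of_forall fun _ => ENNReal.ofReal_lt_top) _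
  rw [h1]
  have h2 : StronglyMeasurable fun p : Space d × Z =>
      (ENNReal.ofReal (O.dens p.1 p.2)).toReal • O.val p.1 p.2 :=
    (hm.ennreal_toReal.smul hval).stronglyMeasurable
  exact h2.integral_prod_right'.measurable

/-- The point `x(a) = (1 - a) x + a y` of the path from `x` to `y`. -/
abbrev pathPoint (x y : Space d) (a : ℝ) : Space d := (1 - a) • x + a • y

lemma measurable_pathPoint :
    Measurable fun q : (Space d × Space d) × ℝ => pathPoint q.1.1 q.1.2 q.2 := by
  have : Continuous fun q : (Space d × Space d) × ℝ => (1 - q.2) • q.1.1 + q.2 • q.1.2 := by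
    fun_prop
  exact this.measurable

lemma measurable_dens_path (hdens : Measurable (Function.uncurry O.dens)) :
    Measurable fun q : (Space d × Space d) × (ℝ × Z) =>
      ENNReal.ofReal (O.dens (pathPoint q.1.1 q.1.2 q.2.1) q.2.2) := by
  refine ENNReal.measurable_ofReal.comp (hdens.comp (Measurable.prodMk ?_ measurable_snd.snd))
  exact measurable_pathPoint.comp (measurable_fst.prodMk measurable_snd.fst)

lemma measurable_dens_pathPoint (hdens : Measurable (Function.uncurry O.dens)) (x y : Space d) :
    Measurable fun q : ℝ × Z => ENNReal.ofReal (O.dens (pathPoint x y q.1) q.2) := by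
  refine ENNReal.measurable_ofReal.comp (hdens.comp (Measurable.prodMk ?_ measurable_snd))
  have : Continuous fun a : ℝ => (1 - a) • x + a • y := by fun_prop
  exact this.measurable.comp measurable_fst

lemma measurable_path_sample (hdens : Measurable (Function.uncurry O.dens)) [SigmaFinite O.base]
    (x y : Space d) :
    Measurable fun a : ℝ => (O.sampleLaw (pathPoint x y a)).map (fun z => (a, z)) := by
  refine Measure.measurable_of_measurable_coe _ fun s hs => ?_
  have hpre : ∀ a : ℝ, MeasurableSet ((fun z : Z => (a, z)) ⁻¹' s) := fun a =>
    measurable_prodMk_left hs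
  simp_rw [Measure.map_apply measurable_prodMk_left hs, sampleLaw, withDensity_apply _ (hpre _),
    ← lintegral_indicator (hpre _)]
  have : Measurable (s.indicator fun q : ℝ × Z =>
      ENNReal.ofReal (O.dens (pathPoint x y q.1) q.2)) :=
    (measurable_dens_pathPoint hdens x y).indicator hs
  exact this.lintegral_prod_right'

lemma pathLaw_eq_withDensity (hdens : Measurable (Function.uncurry O.dens)) [SigmaFinite O.base]
    (x y : Space d) :
    O.pathLaw x y = ((volume.restrict (Set.Icc (0 : ℝ) 1)).prod O.base).withDensity
      (fun q => ENNReal.ofReal (O.dens (pathPoint x y q.1) q.2)) := by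
  have hm : Measurable fun q : ℝ × Z => ENNReal.ofReal (O.dens (pathPoint x y q.1) q.2) :=
    measurable_dens_pathPoint hdens x y
  ext s hs
  have hpre : ∀ a : ℝ, MeasurableSet ((fun z : Z => (a, z)) ⁻¹' s) := fun a =>
    measurable_prodMk_left hs
  rw [pathLaw, Measure.bind_apply hs (measurable_path_sample hdens x y).aemeasurable,
    withDensity_apply _ hs, ← lintegral_indicator hs, lintegral_prod _ (hm.indicator hs).aemeasurable]
  refine lintegral_congr fun a => ?_
  rw [Measure.map_apply measurable_prodMk_left hs, sampleLaw, withDensity_apply _ (hpre a),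
    ← lintegral_indicator (hpre a)]
  rfl

lemma lintegral_pathLaw (hdens : Measurable (Function.uncurry O.dens)) [SigmaFinite O.base]
    (x y : Space d) {f : ℝ × Z → ENNReal} (hf : Measurable f) :
    ∫⁻ q, f q ∂O.pathLaw x y
      = ∫⁻ a in Set.Icc (0 : ℝ) 1, ∫⁻ z, f (a, z) ∂O.sampleLaw (pathPoint x y a) := by
  rw [pathLaw, Measure.lintegral_bind (measurable_path_sample hdens x y).aemeasurable
    hf.aemeasurable]
  exact lintegral_congr fun a => lintegral_map hf measurable_prodMk_left

lemma measurable_pathLaw (hdens : Measurable (Function.uncurry O.dens)) [SigmaFinite O.base] :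
    Measurable fun p : Space d × Space d => O.pathLaw p.1 p.2 := by
  refine Measure.measurable_of_measurable_coe _ fun s hs => ?_
  simp_rw [pathLaw_eq_withDensity hdens, withDensity_apply _ hs]
  exact (measurable_dens_path hdens).lintegral_prod_right'

lemma ae_pathLaw_mem_Icc (hdens : Measurable (Function.uncurry O.dens)) [SigmaFinite O.base]
    (x y : Space d) : ∀ᵐ q ∂O.pathLaw x y, q.1 ∈ Set.Icc (0 : ℝ) 1 := by
  rw [pathLaw_eq_withDensity hdens]
  refine (withDensity_absolutelyContinuous _ _).ae_le ?_
  have h := ae_restrict_mem (μ := (volume : Measure ℝ)) (measurableSet_Icc (a := (0 : ℝ)) (b := 1))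
  exact Measure.quasiMeasurePreserving_fst.ae h

variable (hK : Convex ℝ K) (hprob : ∀ x ∈ K, IsProbabilityMeasure (O.sampleLaw x))

include hK hprob in
lemma isProbabilityMeasure_pathLaw (hdens : Measurable (Function.uncurry O.dens))
    [SigmaFinite O.base] {x y : Space d} (hx : x ∈ K) (hy : y ∈ K) :
    IsProbabilityMeasure (O.pathLaw x y) := by
  refine ⟨?_⟩
  have h := lintegral_pathLaw hdens x y (f := fun _ => 1) measurable_const
  rw [lintegral_one] at h
  rw [h, setLIntegral_congr_fun measurableSet_Icc (g := fun _ => 1)]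
  · simp
  · intro a ha
    have := hprob _ (segment_mem hK hx hy ha)
    simp

end PathLaw

section ScoreIdentity

variable {E : Type*} [NormedAddCommGroup E] [NormedSpace ℝ E]

/-- Derivative of `E_{z ∼ p(·; x)} ψ(x; z)` in direction `u`, as a single-sample estimator. -/
def scoreDeriv (O : StochObjective d Z) (ψ : Space d → Z → E) (x : Space d) (z : Z)
    (u : Space d) : E :=
  fderiv ℝ (fun y => ψ y z) x u + inner ℝ (O.score x z) u • ψ x z

lemma continuousAt_gradient {f : Space d → ℝ} {x : Space d} (hf : ContDiffAt ℝ 2 f x) :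
    ContinuousAt (gradient f) x := (contDiffAt_gradient hf).continuousAt

lemma integral_interval_scoreDeriv [CompleteSpace E] (hK : Convex ℝ K) (h : O.TwiceDiffOn K) {ψ : Space d → Z → E}
    (hψ : ∀ x ∈ K, ∀ z, ContDiffAt ℝ 1 (fun y => ψ y z) x) {x y : Space d} (hx : x ∈ K)
    (hy : y ∈ K) (z : Z) :
    ∫ a in Set.Icc (0 : ℝ) 1, O.dens (pathPoint x y a) z •
        O.scoreDeriv ψ (pathPoint x y a) z (y - x)
      = O.dens y z • ψ y z - O.dens x z • ψ x z := by
  have hpath : ∀ a, HasDerivAt (pathPoint x y) (y - x) a := by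
    intro a
    have h1 : HasDerivAt (fun a : ℝ => (1 - a) • x + a • y) ((-1 : ℝ) • x + (1 : ℝ) • y) a :=
      (((hasDerivAt_id a).const_sub 1).smul_const x).add ((hasDerivAt_id a).smul_const y)
    convert h1 using 1
    module
  have hcont : ∀ a, ContinuousAt (pathPoint x y) a := fun a => (hpath a).continuousAt
  have hderiv : ∀ a ∈ Set.uIcc (0 : ℝ) 1,
      HasDerivAt (fun a => O.dens (pathPoint x y a) z • ψ (pathPoint x y a) z)
        (O.dens (pathPoint x y a) z • O.scoreDeriv ψ (pathPoint x y a) z (y - x)) a := by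
    intro a ha
    rw [Set.uIcc_of_le zero_le_one] at ha
    have hm := segment_mem hK hx hy ha
    have h1 := ((h.dens _ hm z).differentiableAt two_ne_zero).hasFDerivAt.comp_hasDerivAt a (hpath a)
    have h2 := ((hψ _ hm z).differentiableAt one_ne_zero).hasFDerivAt.comp_hasDerivAt a (hpath a)
    refine (h1.smul h2).congr_deriv ?_
    rw [h.hasFDerivAt_dens hm z, scoreDeriv, smul_add, smul_smul]
    rfl
  have hcontOn : ContinuousOn
      (fun a => O.dens (pathPoint x y a) z • O.scoreDeriv ψ (pathPoint x y a) z (y - x))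
      (Set.Icc 0 1) := by
    intro a ha
    have hm := segment_mem hK hx hy ha
    have h1 : ContinuousAt (fun w => O.dens w z) (pathPoint x y a) := (h.dens _ hm z).continuousAt
    have h2 : ContinuousAt (fun w => ψ w z) (pathPoint x y a) := (hψ _ hm z).continuousAt
    have h3 : ContinuousAt (fun w => O.score w z) (pathPoint x y a) :=
      continuousAt_gradient (h.log hm z)
    have h4 : ContinuousAt (fun w => fderiv ℝ (fun v => ψ v z) w) (pathPoint x y a) :=
      ((hψ _ hm z).fderiv_right (m := 0) (by norm_num)).continuousAt
    have h5 : ContinuousAt (fun w => O.dens w z • O.scoreDeriv ψ w z (y - x)) (pathPoint x y a) :=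
      h1.smul ((h4.clm_apply continuousAt_const).add ((h3.inner continuousAt_const).smul h2))
    exact (ContinuousAt.comp h5 (hcont a)).continuousWithinAt
  rw [integral_Icc_eq_integral_Ioc, ← intervalIntegral.integral_of_le zero_le_one,
    intervalIntegral.integral_eq_sub_of_hasDerivAt hderiv
      (hcontOn.intervalIntegrable_of_Icc zero_le_one)]
  simp [pathPoint]

lemma integral_sampleLaw (hdens : Measurable (Function.uncurry O.dens)) {x : Space d}
    (hx : ∀ z, 0 ≤ O.dens x z) (f : Z → E) :
    ∫ z, f z ∂O.sampleLaw x = ∫ z, O.dens x z • f z ∂O.base := by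
  have hm : Measurable fun z => ENNReal.ofReal (O.dens x z) :=
    ENNReal.measurable_ofReal.comp (hdens.comp measurable_prodMk_left)
  rw [sampleLaw, integral_withDensity_eq_integral_toReal_smul hm
    (Filter.Eventually.of_forall fun _ => ENNReal.ofReal_lt_top)]
  simp_rw [ENNReal.toReal_ofReal (hx _)]

lemma integrable_sampleLaw_iff (hdens : Measurable (Function.uncurry O.dens)) {x : Space d}
    (hx : ∀ z, 0 ≤ O.dens x z) (f : Z → E) :
    Integrable f (O.sampleLaw x) ↔ Integrable (fun z => O.dens x z • f z) O.base := by
  have hm : Measurable fun z => ENNReal.ofReal (O.dens x z) :=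
    ENNReal.measurable_ofReal.comp (hdens.comp measurable_prodMk_left)
  rw [sampleLaw, integrable_withDensity_iff_integrable_smul' hm
    (Filter.Eventually.of_forall fun _ => ENNReal.ofReal_lt_top)]
  simp_rw [ENNReal.toReal_ofReal (hx _)]

/-- Differentiation under an expectation whose law depends on the parameter, in integrated form
along a segment: no domination is needed, only integrability of the derivative estimator. -/
lemma integral_pathLaw_scoreDeriv [CompleteSpace E] (hK : Convex ℝ K) (h : O.TwiceDiffOn K)
    (hdens : Measurable (Function.uncurry O.dens)) [SigmaFinite O.base] {ψ : Space d → Z → E}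
    (hψ : ∀ x ∈ K, ∀ z, ContDiffAt ℝ 1 (fun y => ψ y z) x) {x y : Space d} (hx : x ∈ K)
    (hy : y ∈ K) (hix : Integrable (ψ x) (O.sampleLaw x)) (hiy : Integrable (ψ y) (O.sampleLaw y))
    (hi : Integrable (fun q : ℝ × Z => O.scoreDeriv ψ (pathPoint x y q.1) q.2 (y - x))
      (O.pathLaw x y)) :
    ∫ q, O.scoreDeriv ψ (pathPoint x y q.1) q.2 (y - x) ∂O.pathLaw x y
      = ∫ z, ψ y z ∂O.sampleLaw y - ∫ z, ψ x z ∂O.sampleLaw x := by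
  have hm : Measurable fun q : ℝ × Z => ENNReal.ofReal (O.dens (pathPoint x y q.1) q.2) :=
    measurable_dens_pathPoint hdens x y
  have htop : ∀ᵐ q : ℝ × Z ∂(volume.restrict (Set.Icc (0 : ℝ) 1)).prod O.base,
      ENNReal.ofReal (O.dens (pathPoint x y q.1) q.2) < ⊤ :=
    Filter.Eventually.of_forall fun _ => ENNReal.ofReal_lt_top
  rw [pathLaw_eq_withDensity hdens] at hi ⊢
  rw [integrable_withDensity_iff_integrable_smul' hm htop] at hi
  rw [integral_withDensity_eq_integral_toReal_smul hm htop, integral_prod_symm _ hi,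
    integral_sampleLaw hdens (fun z => (h.dens_pos x hx z).le),
    integral_sampleLaw hdens (fun z => (h.dens_pos y hy z).le), ← integral_sub
      ((integrable_sampleLaw_iff hdens (fun z => (h.dens_pos y hy z).le) _).1 hiy)
      ((integrable_sampleLaw_iff hdens (fun z => (h.dens_pos x hx z).le) _).1 hix)]
  refine integral_congr_ae (Filter.Eventually.of_forall fun z => ?_)
  beta_reduce
  rw [← integral_interval_scoreDeriv hK h hψ hx hy z]
  refine setIntegral_congr_fun measurableSet_Icc fun a ha => ?_
  beta_reduce
  rw [ENNReal.toReal_ofReal (h.dens_pos _ (segment_mem hK hx hy ha) z).le]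

end ScoreIdentity

end StochObjective

/-! ### Moment inequalities -/

lemma sq_integral_le_integral_sq {α : Type*} [MeasurableSpace α] {μ : Measure α}
    [IsProbabilityMeasure μ] {f : α → ℝ} (hf : MemLp f 2 μ) :
    (∫ x, f x ∂μ) ^ 2 ≤ ∫ x, f x ^ 2 ∂μ := by
  have h1 := ProbabilityTheory.variance_nonneg f μ
  rw [ProbabilityTheory.variance_eq_sub hf] at h1
  simpa using h1

lemma integral_le_of_integral_sq_le {α : Type*} [MeasurableSpace α] {μ : Measure α}
    [IsProbabilityMeasure μ] {f : α → ℝ} (hf : MemLp f 2 μ) {c : ℝ} (hc : 0 ≤ c)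
    (h : ∫ x, f x ^ 2 ∂μ ≤ c ^ 2) : ∫ x, f x ∂μ ≤ c :=
  le_of_sq_le_sq ((sq_integral_le_integral_sq hf).trans h) hc

lemma memLp_two_of_lintegral_sq_le {α : Type*} [MeasurableSpace α] {μ : Measure α} {d : ℕ}
    {f : α → Space d} (hf : AEStronglyMeasurable f μ) {c : ℝ} (hc : 0 ≤ c)
    (h : ∫⁻ x, ENNReal.ofReal (‖f x‖ ^ 2) ∂μ ≤ ENNReal.ofReal c) :
    MemLp f 2 μ ∧ ∫ x, ‖f x‖ ^ 2 ∂μ ≤ c := by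
  constructor
  · rw [memLp_two_iff_integrable_sq_norm hf]
    refine ⟨hf.norm.pow 2, ?_⟩
    rw [hasFiniteIntegral_iff_ofReal (Filter.Eventually.of_forall fun _ => by positivity)]
    exact h.trans_lt ENNReal.ofReal_lt_top
  · rw [integral_eq_lintegral_of_nonneg_ae (Filter.Eventually.of_forall fun _ => by positivity)
      (hf.norm.aemeasurable.pow_const 2).aestronglyMeasurable]
    exact (ENNReal.toReal_mono ENNReal.ofReal_ne_top h).trans_eq (ENNReal.toReal_ofReal hc)

lemma Lbar_nonneg (B G L : ℝ) : 0 ≤ Lbar B G L := Real.sqrt_nonneg _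

lemma Lbar_sq (B G L : ℝ) :
    Lbar B G L ^ 2 = 4 * B ^ 2 * G ^ 4 + 16 * G ^ 4 + 4 * L ^ 2 + 4 * B ^ 2 * L ^ 2 :=
  Real.sq_sqrt (by positivity)

namespace StochObjective

variable {d : ℕ} {Z : Type*} [MeasurableSpace Z] {O : StochObjective d Z} {K : Set (Space d)}
  {B G L : ℝ}

/-- Standing regularity of the stochastic oracles on a convex set `K`. -/
structure RegularOn (O : StochObjective d Z) (K : Set (Space d)) (B G L : ℝ) : Prop where
  convex : Convex ℝ K
  interior_nonempty : (interior K).Nonempty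
  measurable_val : Measurable (Function.uncurry O.val)
  measurable_dens : Measurable (Function.uncurry O.dens)
  isProbability : ∀ x ∈ K, IsProbabilityMeasure (O.sampleLaw x)
  twiceDiff : O.TwiceDiffOn K
  bounded : O.BoundedOn K B G L

namespace RegularOn

variable (h : O.RegularOn K B G L)
include h

lemma nonneg : 0 ≤ B ∧ 0 ≤ G ∧ 0 ≤ L := by
  obtain ⟨x, hx⟩ := h.interior_nonempty
  have hx := interior_subset hx
  have := h.isProbability x hx
  obtain ⟨z⟩ := nonempty_of_isProbabilityMeasure (O.sampleLaw x)
  exact ⟨(abs_nonneg _).trans (h.bounded.val_le x hx z),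
    (norm_nonneg _).trans (h.bounded.gradVal_le x hx z),
    (norm_nonneg _).trans (h.bounded.hessVal_le x hx z)⟩

lemma measurable_score_right {x : Space d} (hx : x ∈ K) : Measurable (O.score x) := by
  have h1 : Measurable fun p : K × Z => O.score p.1 p.2 :=
    measurable_score h.convex h.interior_nonempty h.twiceDiff h.measurable_dens
  have h2 : Measurable fun z : Z => ((⟨x, hx⟩ : K), z) := measurable_prodMk_left
  have h3 := h1.comp h2
  exact h3

lemma measurable_gradEst_right {x : Space d} (hx : x ∈ K) : Measurable (O.gradEst x) := by
  have h1 : Measurable fun p : K × Z => O.gradEst p.1 p.2 :=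
    measurable_gradEst h.convex h.interior_nonempty h.twiceDiff h.measurable_val h.measurable_dens
  have h2 : Measurable fun z : Z => ((⟨x, hx⟩ : K), z) := measurable_prodMk_left
  have h3 := h1.comp h2
  exact h3

lemma memLp_score_sq {x : Space d} (hx : x ∈ K) :
    MemLp (fun z => ‖O.score x z‖ ^ 2) 2 (O.sampleLaw x) := by
  rw [memLp_two_iff_integrable_sq
    (((h.measurable_score_right hx).norm.pow_const 2).aestronglyMeasurable)]
  simp_rw [← pow_mul]
  exact h.bounded.score_integrable x hx

lemma integrable_score_sq {x : Space d} (hx : x ∈ K) :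
    Integrable (fun z => ‖O.score x z‖ ^ 2) (O.sampleLaw x) := by
  have := h.isProbability x hx
  exact (h.memLp_score_sq hx).integrable one_le_two

lemma integral_score_sq_le {x : Space d} (hx : x ∈ K) :
    ∫ z, ‖O.score x z‖ ^ 2 ∂O.sampleLaw x ≤ G ^ 2 := by
  have := h.isProbability x hx
  refine integral_le_of_integral_sq_le (h.memLp_score_sq hx) (by positivity) ?_
  simp_rw [← pow_mul]
  exact h.bounded.score_le x hx

lemma memLp_score {x : Space d} (hx : x ∈ K) :
    MemLp (fun z => ‖O.score x z‖) 2 (O.sampleLaw x) := by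
  rw [memLp_two_iff_integrable_sq (h.measurable_score_right hx).norm.aestronglyMeasurable]
  exact h.integrable_score_sq hx

lemma integral_score_le {x : Space d} (hx : x ∈ K) :
    ∫ z, ‖O.score x z‖ ∂O.sampleLaw x ≤ G := by
  have := h.isProbability x hx
  exact integral_le_of_integral_sq_le (h.memLp_score hx) h.nonneg.2.1 (h.integral_score_sq_le hx)

lemma norm_gradEst_le {x : Space d} (hx : x ∈ K) (z : Z) :
    ‖O.gradEst x z‖ ≤ G + B * ‖O.score x z‖ := by
  refine (norm_add_le _ _).trans (add_le_add (h.bounded.gradVal_le x hx z) ?_)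
  rw [norm_smul]
  exact mul_le_mul_of_nonneg_right (h.bounded.val_le x hx z) (norm_nonneg _)

lemma lintegral_gradEst_sq_le {x : Space d} (hx : x ∈ K) :
    ∫⁻ z, ENNReal.ofReal (‖O.gradEst x z‖ ^ 2) ∂O.sampleLaw x
      ≤ ENNReal.ofReal ((1 + B) ^ 2 * G ^ 2) := by
  have := h.isProbability x hx
  obtain ⟨hB, hG, -⟩ := h.nonneg
  have i1 : Integrable (fun z => ‖O.score x z‖) (O.sampleLaw x) :=
    (h.memLp_score hx).integrable one_le_two
  have i2 := h.integrable_score_sq hx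
  have hdom : ∀ z, ‖O.gradEst x z‖ ^ 2
      ≤ G ^ 2 + 2 * G * B * ‖O.score x z‖ + B ^ 2 * ‖O.score x z‖ ^ 2 := by
    intro z
    refine (pow_le_pow_left₀ (norm_nonneg _) (h.norm_gradEst_le hx z) 2).trans (le_of_eq ?_)
    ring
  have j1 : Integrable (fun z => G ^ 2 + 2 * G * B * ‖O.score x z‖) (O.sampleLaw x) :=
    (integrable_const _).add (i1.const_mul _)
  have j2 : Integrable (fun z => G ^ 2 + 2 * G * B * ‖O.score x z‖ + B ^ 2 * ‖O.score x z‖ ^ 2)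
    (O.sampleLaw x) := j1.add (i2.const_mul _)
  calc ∫⁻ z, ENNReal.ofReal (‖O.gradEst x z‖ ^ 2) ∂O.sampleLaw x
      ≤ ∫⁻ z, ENNReal.ofReal (G ^ 2 + 2 * G * B * ‖O.score x z‖ + B ^ 2 * ‖O.score x z‖ ^ 2)
          ∂O.sampleLaw x := lintegral_mono fun z => ENNReal.ofReal_le_ofReal (hdom z)
    _ = ENNReal.ofReal (∫ z, (G ^ 2 + 2 * G * B * ‖O.score x z‖ + B ^ 2 * ‖O.score x z‖ ^ 2)
          ∂O.sampleLaw x) := by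
        rw [← ofReal_integral_eq_lintegral_ofReal j2
          (Filter.Eventually.of_forall fun z => by positivity)]
    _ ≤ ENNReal.ofReal ((1 + B) ^ 2 * G ^ 2) := by
        refine ENNReal.ofReal_le_ofReal ?_
        rw [integral_add j1 (i2.const_mul _),
          integral_add (integrable_const _) (i1.const_mul _), integral_const_mul,
          integral_const_mul, integral_const, probReal_univ, one_smul]
        have h1 := mul_le_mul_of_nonneg_left (h.integral_score_le hx)
          (show 0 ≤ 2 * G * B by positivity)
        have h2 := mul_le_mul_of_nonneg_left (h.integral_score_sq_le hx) (sq_nonneg B)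
        linarith

lemma memLp_gradEst {x : Space d} (hx : x ∈ K) : MemLp (O.gradEst x) 2 (O.sampleLaw x) :=
  (memLp_two_of_lintegral_sq_le (h.measurable_gradEst_right hx).aestronglyMeasurable
    (by positivity) (h.lintegral_gradEst_sq_le hx)).1

lemma integral_gradEst_sq_le {x : Space d} (hx : x ∈ K) :
    ∫ z, ‖O.gradEst x z‖ ^ 2 ∂O.sampleLaw x ≤ (1 + B) ^ 2 * G ^ 2 :=
  (memLp_two_of_lintegral_sq_le (h.measurable_gradEst_right hx).aestronglyMeasurable
    (by positivity) (h.lintegral_gradEst_sq_le hx)).2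

lemma norm_hessVec_sq_le {x : Space d} (hx : x ∈ K) (z : Z) (u : Space d) :
    ‖O.hessVec x z u‖ ^ 2 ≤ (4 * B ^ 2 * ‖O.score x z‖ ^ 4 + 16 * G ^ 2 * ‖O.score x z‖ ^ 2
      + 4 * L ^ 2 + 4 * B ^ 2 * ‖O.hessLog x z‖ ^ 2) * ‖u‖ ^ 2 := by
  obtain ⟨hB, hG, hL⟩ := h.nonneg
  have hv := h.bounded.val_le x hx z
  have hg := h.bounded.gradVal_le x hx z
  have hh := h.bounded.hessVal_le x hx z
  set s := ‖O.score x z‖ with hs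
  set l := ‖O.hessLog x z‖ with hl
  have hs0 : 0 ≤ s := norm_nonneg _
  have hu0 : 0 ≤ ‖u‖ := norm_nonneg u
  have i1 : |inner ℝ (O.score x z) u| ≤ s * ‖u‖ := abs_real_inner_le_norm _ _
  have i2 : |inner ℝ (O.gradVal x z) u| ≤ G * ‖u‖ :=
    (abs_real_inner_le_norm _ _).trans (mul_le_mul_of_nonneg_right hg hu0)
  have b1 : ‖(O.val x z * inner ℝ (O.score x z) u) • O.score x z‖ ≤ B * (s * ‖u‖) * s := by
    rw [norm_smul, norm_mul]
    exact mul_le_mul_of_nonneg_right (mul_le_mul hv i1 (abs_nonneg _) hB) hs0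
  have b2 : ‖(inner ℝ (O.score x z) u) • O.gradVal x z‖ ≤ s * ‖u‖ * G := by
    rw [norm_smul]
    exact mul_le_mul i1 hg (norm_nonneg _) (by positivity)
  have b3 : ‖(inner ℝ (O.gradVal x z) u) • O.score x z‖ ≤ G * ‖u‖ * s := by
    rw [norm_smul]
    exact mul_le_mul_of_nonneg_right i2 hs0
  have b4 : ‖O.hessVal x z u‖ ≤ L * ‖u‖ := (O.hessVal x z).le_of_opNorm_le hh u
  have b5 : ‖O.val x z • O.hessLog x z u‖ ≤ B * (l * ‖u‖) := by
    rw [norm_smul]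
    exact mul_le_mul hv ((O.hessLog x z).le_opNorm u) (norm_nonneg _) hB
  have hsum : ‖O.hessVec x z u‖ ≤ (B * s ^ 2 + 2 * G * s + L + B * l) * ‖u‖ := by
    have := norm_add_le (O.firstOrderPart x z u + O.hessVal x z u) (O.val x z • O.hessLog x z u)
    have := norm_add_le (O.firstOrderPart x z u) (O.hessVal x z u)
    have := norm_add₃_le (a := (O.val x z * inner ℝ (O.score x z) u) • O.score x z)
      (b := (inner ℝ (O.score x z) u) • O.gradVal x z)
      (c := (inner ℝ (O.gradVal x z) u) • O.score x z)
    rw [firstOrderPart] at *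
    rw [hessVec, firstOrderPart]
    linarith
  have h4 : ∀ a b c e : ℝ, (a + b + c + e) ^ 2 ≤ 4 * (a ^ 2 + b ^ 2 + c ^ 2 + e ^ 2) := by
    intro a b c e
    nlinarith [sq_nonneg (a - b), sq_nonneg (a - c), sq_nonneg (a - e), sq_nonneg (b - c),
      sq_nonneg (b - e), sq_nonneg (c - e)]
  calc ‖O.hessVec x z u‖ ^ 2 ≤ ((B * s ^ 2 + 2 * G * s + L + B * l) * ‖u‖) ^ 2 :=
        pow_le_pow_left₀ (norm_nonneg _) hsum 2
    _ = (B * s ^ 2 + 2 * G * s + L + B * l) ^ 2 * ‖u‖ ^ 2 := by ring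
    _ ≤ (4 * ((B * s ^ 2) ^ 2 + (2 * G * s) ^ 2 + L ^ 2 + (B * l) ^ 2)) * ‖u‖ ^ 2 :=
        mul_le_mul_of_nonneg_right (h4 _ _ _ _) (by positivity)
    _ = _ := by ring

lemma lintegral_hessVec_sq_le {x : Space d} (hx : x ∈ K) (u : Space d) :
    ∫⁻ z, ENNReal.ofReal (‖O.hessVec x z u‖ ^ 2) ∂O.sampleLaw x
      ≤ ENNReal.ofReal ((Lbar B G L * ‖u‖) ^ 2) := by
  have := h.isProbability x hx
  obtain ⟨hB, hG, hL⟩ := h.nonneg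
  have i4 := h.bounded.score_integrable x hx
  have i2 := h.integrable_score_sq hx
  have il := h.bounded.hessLog_integrable x hx
  have j1 : Integrable (fun z => 4 * B ^ 2 * ‖O.score x z‖ ^ 4 + 16 * G ^ 2 * ‖O.score x z‖ ^ 2)
    (O.sampleLaw x) := (i4.const_mul _).add (i2.const_mul _)
  have j2 : Integrable (fun z => 4 * B ^ 2 * ‖O.score x z‖ ^ 4 + 16 * G ^ 2 * ‖O.score x z‖ ^ 2
      + 4 * L ^ 2) (O.sampleLaw x) := j1.add (integrable_const _)
  have j3 : Integrable (fun z => 4 * B ^ 2 * ‖O.score x z‖ ^ 4 + 16 * G ^ 2 * ‖O.score x z‖ ^ 2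
      + 4 * L ^ 2 + 4 * B ^ 2 * ‖O.hessLog x z‖ ^ 2) (O.sampleLaw x) := j2.add (il.const_mul _)
  calc ∫⁻ z, ENNReal.ofReal (‖O.hessVec x z u‖ ^ 2) ∂O.sampleLaw x
      ≤ ∫⁻ z, ENNReal.ofReal ((4 * B ^ 2 * ‖O.score x z‖ ^ 4 + 16 * G ^ 2 * ‖O.score x z‖ ^ 2
      + 4 * L ^ 2 + 4 * B ^ 2 * ‖O.hessLog x z‖ ^ 2) * ‖u‖ ^ 2) ∂O.sampleLaw x :=
        lintegral_mono fun z => ENNReal.ofReal_le_ofReal (h.norm_hessVec_sq_le hx z u)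
    _ = ENNReal.ofReal (∫ z, (4 * B ^ 2 * ‖O.score x z‖ ^ 4 + 16 * G ^ 2 * ‖O.score x z‖ ^ 2
      + 4 * L ^ 2 + 4 * B ^ 2 * ‖O.hessLog x z‖ ^ 2) * ‖u‖ ^ 2 ∂O.sampleLaw x) := by
        rw [← ofReal_integral_eq_lintegral_ofReal (j3.mul_const (‖u‖ ^ 2))
          (Filter.Eventually.of_forall fun z => by positivity)]
    _ ≤ _ := by
        refine ENNReal.ofReal_le_ofReal ?_
        rw [integral_mul_const, mul_pow, Lbar_sq]
        refine mul_le_mul_of_nonneg_right ?_ (by positivity)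
        rw [integral_add j2 (il.const_mul _), integral_add j1 (integrable_const _),
          integral_add (i4.const_mul _) (i2.const_mul _), integral_const_mul, integral_const_mul,
          integral_const_mul, integral_const_mul, integral_const, probReal_univ, one_smul]
        have h1 := mul_le_mul_of_nonneg_left (h.bounded.score_le x hx)
          (show 0 ≤ 4 * B ^ 2 by positivity)
        have h2 := mul_le_mul_of_nonneg_left (h.integral_score_sq_le hx)
          (show 0 ≤ 16 * G ^ 2 by positivity)
        have h3 := mul_le_mul_of_nonneg_left (h.bounded.hessLog_le x hx)
          (show 0 ≤ 4 * B ^ 2 by positivity)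
        linarith

end RegularOn


variable {d : ℕ} {Z : Type*} [MeasurableSpace Z] {O : StochObjective d Z} {K : Set (Space d)}
  {B G L : ℝ}

/-- The mean `E[∇F̃ + F̃ ∇log p]` of the single-sample gradient estimator, i.e. `∇F` on `K`. -/
def meanGrad (O : StochObjective d Z) (x : Space d) : Space d :=
  ∫ z, O.gradEst x z ∂O.sampleLaw x

/-- Clamping of a real number to `[0, 1]`. -/
abbrev clamp (a : ℝ) : ℝ := Set.projIcc (0 : ℝ) 1 zero_le_one a

lemma clamp_mem (a : ℝ) : clamp a ∈ Set.Icc (0 : ℝ) 1 := (Set.projIcc (0 : ℝ) 1 zero_le_one a).2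

lemma clamp_of_mem {a : ℝ} (ha : a ∈ Set.Icc (0 : ℝ) 1) : clamp a = a := by
  rw [clamp, Set.projIcc_of_mem zero_le_one ha]

lemma measurable_clamp : Measurable clamp :=
  (continuous_subtype_val.comp continuous_projIcc).measurable

lemma measurable_comp_clamped_path (hK : Convex ℝ K) {β : Type*} [MeasurableSpace β]
    {g : Space d → Z → β} (hg : Measurable fun p : K × Z => g p.1 p.2) {x y : Space d}
    (hx : x ∈ K) (hy : y ∈ K) :
    Measurable fun q : ℝ × Z => g (pathPoint x y (clamp q.1)) q.2 := by
  have h1 : Measurable fun a : ℝ =>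
      (⟨pathPoint x y (clamp a), segment_mem hK hx hy (clamp_mem a)⟩ : K) := by
    refine Measurable.subtype_mk ?_
    have : Continuous fun a : ℝ => (1 - a) • x + a • y := by fun_prop
    exact this.measurable.comp measurable_clamp
  exact hg.comp ((h1.comp measurable_fst).prodMk measurable_snd)

lemma measurable_apply_right {g : Space d → Z → Space d → Space d}
    (hg : Measurable fun p : (K × Z) × Space d => g p.1.1 p.1.2 p.2) (u : Space d) :
    Measurable fun p : K × Z => g p.1 p.2 u := by
  have h1 : Measurable fun p : K × Z => (p, u) := measurable_id.prodMk measurable_const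
  have h2 := hg.comp h1
  exact h2

namespace RegularOn

variable (h : O.RegularOn K B G L)
include h

lemma ae_path_clamp [SigmaFinite O.base] {β : Type*} (g : Space d → Z → β) (x y : Space d) :
    (fun q : ℝ × Z => g (pathPoint x y q.1) q.2)
      =ᵐ[O.pathLaw x y] fun q => g (pathPoint x y (clamp q.1)) q.2 := by
  filter_upwards [ae_pathLaw_mem_Icc h.measurable_dens x y] with q hq
  rw [clamp_of_mem hq]

lemma measurable_hessVec_apply (u : Space d) :
    Measurable fun p : K × Z => O.hessVec p.1 p.2 u :=
  measurable_apply_right (measurable_hessVec h.convex h.interior_nonempty h.twiceDiff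
    h.measurable_val h.measurable_dens) u

variable [SigmaFinite O.base] {x y : Space d} (hx : x ∈ K) (hy : y ∈ K)
include hx hy

lemma aemeasurable_path {β : Type*} [MeasurableSpace β] {g : Space d → Z → β}
    (hg : Measurable fun p : K × Z => g p.1 p.2) :
    AEMeasurable (fun q : ℝ × Z => g (pathPoint x y q.1) q.2) (O.pathLaw x y) :=
  ⟨_, measurable_comp_clamped_path h.convex hg hx hy, h.ae_path_clamp g x y⟩

lemma memLp_path {g : Space d → Z → Space d} (hg : Measurable fun p : K × Z => g p.1 p.2)
    {c : ℝ} (hc : 0 ≤ c)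
    (hgc : ∀ w ∈ K, ∫⁻ z, ENNReal.ofReal (‖g w z‖ ^ 2) ∂O.sampleLaw w ≤ ENNReal.ofReal c) :
    MemLp (fun q : ℝ × Z => g (pathPoint x y q.1) q.2) 2 (O.pathLaw x y) ∧
      ∫ q, ‖g (pathPoint x y q.1) q.2‖ ^ 2 ∂O.pathLaw x y ≤ c := by
  have := isProbabilityMeasure_pathLaw h.convex h.isProbability h.measurable_dens hx hy
  refine memLp_two_of_lintegral_sq_le (h.aemeasurable_path hx hy hg).aestronglyMeasurable hc ?_
  have hm : Measurable fun q : ℝ × Z =>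
      ENNReal.ofReal (‖g (pathPoint x y (clamp q.1)) q.2‖ ^ 2) :=
    ENNReal.measurable_ofReal.comp
      ((measurable_comp_clamped_path h.convex hg hx hy).norm.pow_const 2)
  rw [lintegral_congr_ae (h.ae_path_clamp (fun w z => ENNReal.ofReal (‖g w z‖ ^ 2)) x y),
    lintegral_pathLaw h.measurable_dens x y hm]
  calc _ ≤ ∫⁻ _ in Set.Icc (0 : ℝ) 1, ENNReal.ofReal c := by
        refine setLIntegral_mono measurable_const fun a ha => ?_
        simp only [clamp_of_mem ha]
        exact hgc _ (segment_mem h.convex hx hy ha)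
    _ = ENNReal.ofReal c := by simp

lemma integral_pathLaw {E : Type*} [NormedAddCommGroup E] [NormedSpace ℝ E] {f : ℝ × Z → E}
    (hf : Integrable f (O.pathLaw x y)) :
    ∫ q, f q ∂O.pathLaw x y
      = ∫ a in Set.Icc (0 : ℝ) 1, ∫ z, f (a, z) ∂O.sampleLaw (pathPoint x y a) := by
  have hm := measurable_dens_pathPoint h.measurable_dens x y
  have htop : ∀ᵐ q : ℝ × Z ∂(volume.restrict (Set.Icc (0 : ℝ) 1)).prod O.base,
      ENNReal.ofReal (O.dens (pathPoint x y q.1) q.2) < ⊤ :=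
    Filter.Eventually.of_forall fun _ => ENNReal.ofReal_lt_top
  rw [pathLaw_eq_withDensity h.measurable_dens] at hf ⊢
  rw [integrable_withDensity_iff_integrable_smul' hm htop] at hf
  rw [integral_withDensity_eq_integral_toReal_smul hm htop, integral_prod _ hf]
  refine setIntegral_congr_fun measurableSet_Icc fun a ha => ?_
  have hp := fun z => (h.twiceDiff.dens_pos _ (segment_mem h.convex hx hy ha) z).le
  rw [integral_sampleLaw h.measurable_dens hp]
  simp_rw [ENNReal.toReal_ofReal (hp _)]

lemma memLp_hessVec_path (u : Space d) :
    MemLp (fun q : ℝ × Z => O.hessVec (pathPoint x y q.1) q.2 u) 2 (O.pathLaw x y) ∧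
      ∫ q, ‖O.hessVec (pathPoint x y q.1) q.2 u‖ ^ 2 ∂O.pathLaw x y ≤ (Lbar B G L * ‖u‖) ^ 2 :=
  h.memLp_path hx hy (g := fun w z => O.hessVec w z u)
    (h.measurable_hessVec_apply u)
    (by positivity) fun _ hw => h.lintegral_hessVec_sq_le hw u

lemma integral_hessVec_path :
    ∫ q, O.hessVec (pathPoint x y q.1) q.2 (y - x) ∂O.pathLaw x y
      = O.meanGrad y - O.meanGrad x := by
  have hpx := h.isProbability x hx
  have hpy := h.isProbability y hy
  have := isProbabilityMeasure_pathLaw h.convex h.isProbability h.measurable_dens hx hy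
  have hae : (fun q : ℝ × Z => O.hessVec (pathPoint x y q.1) q.2 (y - x))
      =ᵐ[O.pathLaw x y] fun q => O.scoreDeriv O.gradEst (pathPoint x y q.1) q.2 (y - x) := by
    filter_upwards [ae_pathLaw_mem_Icc h.measurable_dens x y] with q hq
    exact (h.twiceDiff.fderiv_gradEst (segment_mem h.convex hx hy hq) q.2 (y - x)).symm
  rw [integral_congr_ae hae]
  refine integral_pathLaw_scoreDeriv h.convex h.twiceDiff h.measurable_dens
    (fun w hw z => h.twiceDiff.contDiffAt_gradEst hw z) hx hy
    ((h.memLp_gradEst hx).integrable one_le_two) ((h.memLp_gradEst hy).integrable one_le_two) ?_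
  exact ((h.memLp_hessVec_path hx hy (y - x)).1.integrable one_le_two).congr hae

lemma norm_meanGrad_sub_le : ‖O.meanGrad y - O.meanGrad x‖ ≤ Lbar B G L * ‖y - x‖ := by
  have := isProbabilityMeasure_pathLaw h.convex h.isProbability h.measurable_dens hx hy
  obtain ⟨h1, h2⟩ := h.memLp_hessVec_path hx hy (y - x)
  rw [← h.integral_hessVec_path hx hy]
  exact (norm_integral_le_integral_norm _).trans (integral_le_of_integral_sq_le h1.norm
    (mul_nonneg (Lbar_nonneg _ _ _) (norm_nonneg _)) h2)

lemma objective_sub_eq (hval : ∀ w ∈ K, Integrable (O.val w) (O.sampleLaw w)) :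
    O.objective y - O.objective x
      = ∫ a in Set.Icc (0 : ℝ) 1, inner ℝ (O.meanGrad (pathPoint x y a)) (y - x) := by
  have := isProbabilityMeasure_pathLaw h.convex h.isProbability h.measurable_dens hx hy
  have hG : MemLp (fun q : ℝ × Z => O.gradEst (pathPoint x y q.1) q.2) 2 (O.pathLaw x y) :=
    (h.memLp_path hx hy (measurable_gradEst h.convex h.interior_nonempty h.twiceDiff
      h.measurable_val h.measurable_dens) (by positivity)
      fun _ hw => h.lintegral_gradEst_sq_le hw).1
  have hint : Integrable (fun q : ℝ × Z => inner ℝ (O.gradEst (pathPoint x y q.1) q.2) (y - x))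
      (O.pathLaw x y) := (hG.integrable one_le_two).inner_const _
  have hae : (fun q : ℝ × Z => inner ℝ (O.gradEst (pathPoint x y q.1) q.2) (y - x))
      =ᵐ[O.pathLaw x y] fun q => O.scoreDeriv O.val (pathPoint x y q.1) q.2 (y - x) := by
    refine Filter.Eventually.of_forall fun q => ?_
    simp only [gradEst, scoreDeriv]
    rw [← inner_gradient, inner_add_left, real_inner_smul_left, smul_eq_mul, mul_comm]
    rfl
  have key := integral_pathLaw_scoreDeriv h.convex h.twiceDiff h.measurable_dens (ψ := O.val)
    (fun w hw z => (h.twiceDiff.val w hw z).of_le (by norm_num)) hx hy (hval x hx) (hval y hy)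
    (hint.congr hae)
  rw [objective, objective, ← key, ← integral_congr_ae hae, h.integral_pathLaw hx hy hint]
  refine setIntegral_congr_fun measurableSet_Icc fun a ha => ?_
  have hm := segment_mem h.convex hx hy ha
  have hp := h.isProbability _ hm
  have hi : Integrable (O.gradEst (pathPoint x y a)) (O.sampleLaw (pathPoint x y a)) :=
    (h.memLp_gradEst hm).integrable one_le_two
  simp_rw [real_inner_comm (y - x)]
  rw [integral_inner hi, meanGrad]

omit hx hy in
lemma smoothOn (hval : ∀ w ∈ K, Integrable (O.val w) (O.sampleLaw w)) :
    SmoothOn O.objective O.meanGrad K (Lbar B G L) := by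
  refine ⟨fun x hx y hy => ?_, fun x hx y hy => h.norm_meanGrad_sub_le hx hy⟩
  have hcontK : ContinuousOn O.meanGrad K := by
    have : LipschitzOnWith (Real.toNNReal (Lbar B G L)) O.meanGrad K := by
      refine LipschitzOnWith.of_dist_le_mul fun x hx y hy => ?_
      rw [dist_eq_norm, dist_eq_norm, Real.coe_toNNReal _ (Lbar_nonneg _ _ _)]
      exact h.norm_meanGrad_sub_le hy hx
    exact this.continuousOn
  have hpath : Continuous (pathPoint x y) := by
    have : Continuous fun a : ℝ => (1 - a) • x + a • y := by fun_prop
    exact this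
  have hcont : ContinuousOn (fun a => inner ℝ (O.meanGrad (pathPoint x y a)) (y - x))
      (Set.Icc (0 : ℝ) 1) :=
    (hcontK.comp hpath.continuousOn fun a ha => segment_mem h.convex hx hy ha).inner
      continuousOn_const
  have hconst : inner ℝ (O.meanGrad x) (y - x)
      = ∫ _ in Set.Icc (0 : ℝ) 1, inner ℝ (O.meanGrad x) (y - x) := by simp
  rw [h.objective_sub_eq hx hy hval, hconst, ← integral_sub
    (hcont.integrableOn_compact isCompact_Icc) (by simp)]
  have hval : ∫ a in Set.Icc (0 : ℝ) 1, (Lbar B G L * ‖y - x‖ ^ 2) * a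
      = Lbar B G L / 2 * ‖y - x‖ ^ 2 := by
    rw [integral_const_mul, integral_Icc_eq_integral_Ioc,
      ← intervalIntegral.integral_of_le zero_le_one, integral_id]
    ring
  rw [← hval, ← Real.norm_eq_abs]
  refine norm_integral_le_of_norm_le
    ((continuous_const.mul continuous_id).continuousOn.integrableOn_compact isCompact_Icc) ?_
  filter_upwards [ae_restrict_mem measurableSet_Icc] with a ha
  rw [← inner_sub_left]
  refine (norm_inner_le_norm _ _).trans ?_
  have h1 := h.norm_meanGrad_sub_le hx (segment_mem h.convex hx hy ha)
  have h2 : (1 - a) • x + a • y - x = a • (y - x) := by module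
  rw [h2, norm_smul, Real.norm_of_nonneg ha.1] at h1
  calc _ ≤ Lbar B G L * (a * ‖y - x‖) * ‖y - x‖ := mul_le_mul_of_nonneg_right h1 (norm_nonneg _)
    _ = _ := by ring

end RegularOn

/-- `hv` is a measurable oracle for products of the stochastic Hessian with vectors of norm at most
`R`, with relative error at most `τ`. -/
structure ApproxHessVec (O : StochObjective d Z) (K : Set (Space d))
    (hv : Space d → Z → Space d → Space d) (R τ : ℝ) : Prop where
  measurable : Measurable fun p : (K × Z) × Metric.closedBall (0 : Space d) R => hv p.1.1 p.1.2 p.2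
  error_le : ∀ x ∈ K, ∀ z, ∀ u, ‖u‖ ≤ R → ‖hv x z u - O.hessVec x z u‖ ≤ τ * ‖u‖

namespace ApproxHessVec

variable {hv : Space d → Z → Space d → Space d} {R τ : ℝ} (ha : O.ApproxHessVec K hv R τ)
  (h : O.RegularOn K B G L)
include h ha

variable [SigmaFinite O.base] {x y : Space d} (hx : x ∈ K) (hy : y ∈ K) (hxy : ‖y - x‖ ≤ R)
include hx hy hxy

lemma memLp_path (hτ : 0 ≤ τ) :
    MemLp (fun q : ℝ × Z => hv (pathPoint x y q.1) q.2 (y - x)) 2 (O.pathLaw x y) ∧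
      ∫ q, ‖hv (pathPoint x y q.1) q.2 (y - x)‖ ^ 2 ∂O.pathLaw x y
        ≤ ((Lbar B G L + τ) * ‖y - x‖) ^ 2 := by
  have := isProbabilityMeasure_pathLaw h.convex h.isProbability h.measurable_dens hx hy
  obtain ⟨m1, m2⟩ := h.memLp_hessVec_path hx hy (y - x)
  have hmeas : AEStronglyMeasurable (fun q : ℝ × Z => hv (pathPoint x y q.1) q.2 (y - x))
      (O.pathLaw x y) := by
    refine (h.aemeasurable_path hx hy (g := fun w z => hv w z (y - x)) ?_).aestronglyMeasurable
    exact ha.measurable.comp (measurable_id.prodMk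
      (measurable_const (a := (⟨y - x, by simpa using hxy⟩ : Metric.closedBall (0 : Space d) R))))
  have hle : ∀ᵐ q ∂O.pathLaw x y, ‖hv (pathPoint x y q.1) q.2 (y - x)‖
      ≤ ‖O.hessVec (pathPoint x y q.1) q.2 (y - x)‖ + τ * ‖y - x‖ := by
    filter_upwards [ae_pathLaw_mem_Icc h.measurable_dens x y] with q hq
    have h1 := ha.error_le _ (segment_mem h.convex hx hy hq) q.2 (y - x) hxy
    have h2 := norm_sub_norm_le (hv (pathPoint x y q.1) q.2 (y - x))
      (O.hessVec (pathPoint x y q.1) q.2 (y - x))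
    linarith
  have hL : 0 ≤ Lbar B G L * ‖y - x‖ := mul_nonneg (Lbar_nonneg _ _ _) (norm_nonneg _)
  have hc : 0 ≤ τ * ‖y - x‖ := by positivity
  have hdom : MemLp (fun q : ℝ × Z => ‖O.hessVec (pathPoint x y q.1) q.2 (y - x)‖
      + τ * ‖y - x‖) 2 (O.pathLaw x y) := m1.norm.add (memLp_const _)
  have hmem : MemLp (fun q : ℝ × Z => hv (pathPoint x y q.1) q.2 (y - x)) 2 (O.pathLaw x y) := by
    refine hdom.mono hmeas ?_
    filter_upwards [hle] with q hq
    exact hq.trans (le_abs_self _)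
  refine ⟨hmem, ?_⟩
  have i1 : Integrable (fun q : ℝ × Z => ‖O.hessVec (pathPoint x y q.1) q.2 (y - x)‖)
    (O.pathLaw x y) := m1.norm.integrable one_le_two
  have i2 : Integrable (fun q : ℝ × Z => ‖O.hessVec (pathPoint x y q.1) q.2 (y - x)‖ ^ 2)
    (O.pathLaw x y) := m1.norm.integrable_sq
  have j1 : Integrable (fun q : ℝ × Z => ‖O.hessVec (pathPoint x y q.1) q.2 (y - x)‖ ^ 2
    + 2 * (τ * ‖y - x‖) * ‖O.hessVec (pathPoint x y q.1) q.2 (y - x)‖) (O.pathLaw x y) :=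
    i2.add (i1.const_mul _)
  calc ∫ q, ‖hv (pathPoint x y q.1) q.2 (y - x)‖ ^ 2 ∂O.pathLaw x y
      ≤ ∫ q, (‖O.hessVec (pathPoint x y q.1) q.2 (y - x)‖ ^ 2
    + 2 * (τ * ‖y - x‖) * ‖O.hessVec (pathPoint x y q.1) q.2 (y - x)‖ + (τ * ‖y - x‖) ^ 2)
      ∂O.pathLaw x y := by
        refine integral_mono_ae hmem.norm.integrable_sq (j1.add (integrable_const _)) ?_
        filter_upwards [hle] with q hq
        refine (pow_le_pow_left₀ (norm_nonneg _) hq 2).trans (le_of_eq (by ring))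
    _ ≤ ((Lbar B G L + τ) * ‖y - x‖) ^ 2 := by
        rw [integral_add j1 (integrable_const _), integral_add i2 (i1.const_mul _),
          integral_const_mul, integral_const, probReal_univ, one_smul]
        have h1 := integral_le_of_integral_sq_le m1.norm hL m2
        have h2 := mul_le_mul_of_nonneg_left h1 (mul_nonneg zero_le_two hc)
        linarith

lemma norm_integral_path_sub_le (hτ : 0 ≤ τ) :
    ‖∫ q, hv (pathPoint x y q.1) q.2 (y - x) ∂O.pathLaw x y - (O.meanGrad y - O.meanGrad x)‖
      ≤ τ * ‖y - x‖ := by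
  have := isProbabilityMeasure_pathLaw h.convex h.isProbability h.measurable_dens hx hy
  have m1 := (h.memLp_hessVec_path hx hy (y - x)).1
  have hle : ∀ᵐ q ∂O.pathLaw x y, ‖hv (pathPoint x y q.1) q.2 (y - x)
      - O.hessVec (pathPoint x y q.1) q.2 (y - x)‖ ≤ τ * ‖y - x‖ := by
    filter_upwards [ae_pathLaw_mem_Icc h.measurable_dens x y] with q hq
    exact ha.error_le _ (segment_mem h.convex hx hy hq) q.2 (y - x) hxy
  rw [← h.integral_hessVec_path hx hy, ← integral_sub
    ((ha.memLp_path h hx hy hxy hτ).1.integrable one_le_two) (m1.integrable one_le_two)]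
  simpa using norm_integral_le_of_norm_le_const hle

end ApproxHessVec

end StochObjective

/-! ### Minibatches -/

section Minibatch

variable {d : ℕ} {Ω : Type*} [MeasurableSpace Ω] {ρ : Measure Ω}

lemma minibatch_eq {m : ℕ} {S : Type*} (oracle : S → Space d) (cost : ℕ) (b : Fin m → S) :
    minibatch oracle cost b = ((1 / (m : ℝ)) • ∑ k, oracle (b k), m * cost) := by
  simp [minibatch, Prod.fst_sum, Prod.snd_sum]

lemma memLp_apply {X : Ω → Space d} (hX : MemLp X 2 ρ) (j : Fin d) :
    MemLp (fun ω => X ω j) 2 ρ :=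
  (EuclideanSpace.proj j : Space d →L[ℝ] ℝ).comp_memLp' hX

variable [IsProbabilityMeasure ρ]

open ProbabilityTheory in
lemma integral_sq_average {m : ℕ} (hm : 0 < m) {f : Ω → ℝ} (hf : MemLp f 2 ρ) (w : ℝ) :
    Integrable (fun b : Fin m → Ω => (w + (1 / (m : ℝ)) * ∑ k, f (b k)) ^ 2)
      (Measure.pi fun _ => ρ) ∧
    ∫ b : Fin m → Ω, (w + (1 / (m : ℝ)) * ∑ k, f (b k)) ^ 2 ∂(Measure.pi fun _ => ρ)
      ≤ (w + ∫ ω, f ω ∂ρ) ^ 2 + (1 / (m : ℝ)) * ∫ ω, f ω ^ 2 ∂ρ := by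
  have hm' : (m : ℝ) ≠ 0 := by exact_mod_cast hm.ne'
  have hpres : ∀ k : Fin m, MeasurePreserving (Function.eval k) (Measure.pi fun _ : Fin m => ρ) ρ :=
    fun k => measurePreserving_eval (fun _ : Fin m => ρ) k
  have hk : ∀ k : Fin m, MemLp (fun b : Fin m → Ω => f (b k)) 2 (Measure.pi fun _ => ρ) :=
    fun k => hf.comp_measurePreserving (hpres k)
  have hsum : MemLp (fun b : Fin m → Ω => ∑ k, f (b k)) 2 (Measure.pi fun _ => ρ) :=
    memLp_finsetSum _ fun k _ => hk k
  have hS : MemLp (fun b : Fin m → Ω => w + (1 / (m : ℝ)) * ∑ k, f (b k)) 2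
      (Measure.pi fun _ => ρ) := (memLp_const w).add (hsum.const_mul _)
  refine ⟨hS.integrable_sq, ?_⟩
  have hmean : ∫ b : Fin m → Ω, (w + (1 / (m : ℝ)) * ∑ k, f (b k)) ∂(Measure.pi fun _ => ρ)
      = w + ∫ ω, f ω ∂ρ := by
    rw [integral_add (integrable_const _) ((hsum.integrable one_le_two).const_mul _),
      integral_const, probReal_univ, one_smul, integral_const_mul,
      integral_finsetSum _ fun k _ => (hk k).integrable one_le_two]
    have : ∀ k : Fin m, ∫ b : Fin m → Ω, f (b k) ∂(Measure.pi fun _ => ρ) = ∫ ω, f ω ∂ρ := by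
      intro k
      have h1 := integral_map (hpres k).measurable.aemeasurable (f := f)
        (by rw [(hpres k).map_eq]; exact hf.aestronglyMeasurable)
      rw [(hpres k).map_eq] at h1
      exact h1.symm
    simp_rw [this]
    simp only [Finset.sum_const, Finset.card_univ, Fintype.card_fin, nsmul_eq_mul]
    field_simp
  have hvar : Var[fun b : Fin m → Ω => w + (1 / (m : ℝ)) * ∑ k, f (b k); Measure.pi fun _ => ρ]
      = (1 / (m : ℝ)) * Var[f; ρ] := by
    rw [variance_const_add (hsum.const_mul _).aestronglyMeasurable, variance_const_mul]
    have h1 := variance_sum_pi (μ := fun _ : Fin m => ρ) (X := fun _ => f) fun _ => hf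
    have h2 : (∑ i : Fin m, fun ω : Fin m → Ω => f (ω i)) = fun b => ∑ k, f (b k) := by
      ext b
      simp
    rw [h2] at h1
    rw [h1]
    simp only [Finset.sum_const, Finset.card_univ, Fintype.card_fin, nsmul_eq_mul]
    field_simp
  have h1 := variance_eq_sub hS
  rw [hvar, hmean] at h1
  have h2 : Var[f; ρ] ≤ ∫ ω, f ω ^ 2 ∂ρ := by
    rw [variance_eq_sub hf]
    have := sq_nonneg (∫ ω, f ω ∂ρ)
    simp only [Pi.pow_apply]
    linarith
  have h3 := mul_le_mul_of_nonneg_left h2 (show 0 ≤ 1 / (m : ℝ) by positivity)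
  simp only [Pi.pow_apply] at h1
  linarith

/-- Second moment of a shifted minibatch average around an arbitrary point. -/
lemma lintegral_norm_sq_average {m : ℕ} (hm : 0 < m) {X : Ω → Space d} (hX : MemLp X 2 ρ)
    (w : Space d) :
    ∫⁻ b : Fin m → Ω, ENNReal.ofReal (‖w + (1 / (m : ℝ)) • ∑ k, X (b k)‖ ^ 2)
        ∂(Measure.pi fun _ => ρ)
      ≤ ENNReal.ofReal (‖w + ∫ ω, X ω ∂ρ‖ ^ 2 + (1 / (m : ℝ)) * ∫ ω, ‖X ω‖ ^ 2 ∂ρ) := by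
  have hj := fun j => integral_sq_average hm (memLp_apply hX j) (w j)
  have hmean : ∀ j, (∫ ω, X ω ∂ρ) j = ∫ ω, X ω j ∂ρ := fun j =>
    ((EuclideanSpace.proj j : Space d →L[ℝ] ℝ).integral_comp_comm
      (hX.integrable one_le_two)).symm
  have hnorm : ∀ b : Fin m → Ω, ‖w + (1 / (m : ℝ)) • ∑ k, X (b k)‖ ^ 2
      = ∑ j, (w j + (1 / (m : ℝ)) * ∑ k, X (b k) j) ^ 2 := by
    intro b
    rw [EuclideanSpace.real_norm_sq_eq]
    simp
  simp_rw [hnorm]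
  rw [← ofReal_integral_eq_lintegral_ofReal (integrable_finsetSum _ fun j _ => (hj j).1)
    (Filter.Eventually.of_forall fun b => Finset.sum_nonneg fun j _ => sq_nonneg _),
    integral_finsetSum _ fun j _ => (hj j).1]
  refine ENNReal.ofReal_le_ofReal ((Finset.sum_le_sum fun j _ => (hj j).2).trans (le_of_eq ?_))
  rw [Finset.sum_add_distrib, ← Finset.mul_sum, EuclideanSpace.real_norm_sq_eq]
  congr 1
  · refine Finset.sum_congr rfl fun j _ => ?_
    rw [PiLp.add_apply, hmean]
  · congr 1
    simp_rw [EuclideanSpace.real_norm_sq_eq]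
    exact (integral_finsetSum _ fun j _ => (memLp_apply hX j).integrable_sq).symm

end Minibatch

/-! ### Measurable dependence of product measures on a parameter -/

section ProductKernel

variable {α Ω β : Type*} [MeasurableSpace α] [MeasurableSpace Ω] [MeasurableSpace β]
  {κ : α → Measure Ω} [∀ a, IsProbabilityMeasure (κ a)]

lemma measurable_pi_const (hκ : Measurable κ) (m : ℕ) :
    Measurable fun a => Measure.pi fun _ : Fin m => κ a := by
  refine Measurable.measure_of_isPiSystem_of_isProbabilityMeasure generateFrom_pi.symm
    isPiSystem_pi ?_
  rintro _ ⟨s, hs, rfl⟩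
  simp_rw [Measure.pi_pi]
  exact Finset.measurable_prod _ fun i _ =>
    (Measure.measurable_coe (hs i (Set.mem_univ i))).comp hκ

lemma measurable_map_pi_const (hκ : Measurable κ) {m : ℕ} {f : α → (Fin m → Ω) → β}
    (hf : Measurable (Function.uncurry f)) :
    Measurable fun a => (Measure.pi fun _ : Fin m => κ a).map (f a) := by
  let η : ProbabilityTheory.Kernel α (Fin m → Ω) :=
    ⟨fun a => Measure.pi fun _ => κ a, measurable_pi_const hκ m⟩
  have : ProbabilityTheory.IsMarkovKernel η := ⟨fun a => by
    change IsProbabilityMeasure (Measure.pi fun _ : Fin m => κ a)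
    infer_instance⟩
  refine Measure.measurable_of_measurable_coe _ fun s hs => ?_
  have heq : (fun a => (Measure.pi fun _ : Fin m => κ a).map (f a) s)
      = fun a => η a (Prod.mk a ⁻¹' (Function.uncurry f ⁻¹' s)) := by
    funext a
    have hfa : Measurable (f a) := hf.comp (measurable_prodMk_left (x := a))
    rw [Measure.map_apply hfa hs]
    rfl
  rw [heq]
  exact ProbabilityTheory.Kernel.measurable_kernel_prodMk_left (κ := η) (hf hs)

open Classical in
lemma aemeasurable_of_measurable_subtype {f : α → β} [Nonempty β] {μ : Measure α} {S : Set α}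
    (hS : MeasurableSet S) (hμ : ∀ᵐ a ∂μ, a ∈ S) (hf : Measurable fun a : S => f a) :
    AEMeasurable f μ := by
  obtain ⟨c⟩ := ‹Nonempty β›
  refine ⟨fun a => if h : a ∈ S then f (⟨a, h⟩ : S) else c,
    Measurable.dite hf measurable_const hS, ?_⟩
  filter_upwards [hμ] with a ha
  simp [ha]

end ProductKernel

/-! ### One iteration -/

section Iteration

variable {d : ℕ}

lemma State.measurable_prev : Measurable (State.prev : State d → Space d) := measurable_fst
lemma State.measurable_cur : Measurable (State.cur : State d → Space d) := measurable_snd.fst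
lemma State.measurable_grad : Measurable (State.grad : State d → Space d) := measurable_snd.snd.fst
lemma State.measurable_calls : Measurable (State.calls : State d → ℕ) := measurable_snd.snd.snd

/-- What one iteration from the state `s` does almost surely, when it makes `n` oracle calls. -/
structure IsStep (lmo : Space d → Space d) (T n : ℕ) (s : State d) (η : Measure (State d)) :
    Prop where
  isProbability : IsProbabilityMeasure η
  prev_eq : ∀ᵐ s' ∂η, s'.prev = s.cur
  cur_eq : ∀ᵐ s' ∂η, s'.cur = s'.prev + (1 / (T : ℝ)) • lmo s'.grad
  calls_eq : ∀ᵐ s' ∂η, s'.calls = s.calls + n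

variable {lmo : Space d → Space d} (hlmo : Measurable lmo) {Ω : Type*} [MeasurableSpace Ω]
  {ρ : Measure Ω} [IsProbabilityMeasure ρ] {X : Ω → Space d}

include hlmo in
lemma measurable_move (T : ℕ) :
    Measurable fun p : State d × Space d × ℕ => move lmo T p.1 p.2.1 p.2.2 := by
  unfold move State.cur
  fun_prop

omit [MeasurableSpace Ω] in
/-- The state reached from `s` with the minibatch `b`. -/
def batchMove {m : ℕ} (lmo : Space d → Space d) (T : ℕ) (s : State d) (g : Space d) (n : ℕ)
    (X : Ω → Space d) (b : Fin m → Ω) : State d :=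
  move lmo T s (g + (1 / (m : ℝ)) • ∑ k, X (b k)) n

lemma aemeasurable_average {m : ℕ} (hX : AEMeasurable X ρ) (g : Space d) :
    AEMeasurable (fun b : Fin m → Ω => g + (1 / (m : ℝ)) • ∑ k, X (b k))
      (Measure.pi fun _ => ρ) := by
  have hk : ∀ k : Fin m, AEMeasurable (fun b : Fin m → Ω => X (b k)) (Measure.pi fun _ => ρ) :=
    fun k => hX.comp_quasiMeasurePreserving
      (measurePreserving_eval (fun _ : Fin m => ρ) k).quasiMeasurePreserving
  have hs : AEMeasurable (fun b : Fin m → Ω => (1 / (m : ℝ)) • ∑ k, X (b k))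
      (Measure.pi fun _ => ρ) :=
    AEMeasurable.const_smul (Finset.aemeasurable_fun_sum Finset.univ fun k _ => hk k) (1 / (m : ℝ))
  exact aemeasurable_const.add hs

include hlmo in
lemma aemeasurable_batchMove {m : ℕ} (hX : AEMeasurable X ρ) (T : ℕ) (s : State d) (g : Space d)
    (n : ℕ) :
    AEMeasurable (batchMove (m := m) lmo T s g n X) (Measure.pi fun _ => ρ) := by
  have h1 := aemeasurable_average (m := m) hX g
  exact (measurable_move hlmo T).comp_aemeasurable
    (aemeasurable_const.prodMk (h1.prodMk aemeasurable_const))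

include hlmo in
lemma isStep_batchMove {m : ℕ} (hX : AEMeasurable X ρ) (T : ℕ) (s : State d) (g : Space d)
    (n : ℕ) :
    IsStep lmo T n s ((Measure.pi fun _ : Fin m => ρ).map
      (batchMove lmo T s g (s.calls + n) X)) := by
  have hm := aemeasurable_batchMove (m := m) hlmo hX T s g (s.calls + n)
  refine ⟨Measure.isProbabilityMeasure_map hm, ?_, ?_, ?_⟩
  · rw [ae_map_iff hm (measurableSet_eq_fun State.measurable_prev measurable_const)]
    exact Filter.Eventually.of_forall fun b => rfl
  · have hr : Measurable fun s' : State d => s'.prev + (1 / (T : ℝ)) • lmo s'.grad := by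
      unfold State.prev State.grad
      fun_prop
    rw [ae_map_iff hm (measurableSet_eq_fun State.measurable_cur hr)]
    exact Filter.Eventually.of_forall fun b => rfl
  · rw [ae_map_iff hm (measurableSet_eq_fun State.measurable_calls measurable_const)]
    exact Filter.Eventually.of_forall fun b => rfl

include hlmo in
lemma lintegral_batchMove_le {m : ℕ} (hm : 0 < m) (hX : MemLp X 2 ρ) (T : ℕ) (s : State d)
    (g v : Space d) (n : ℕ) :
    ∫⁻ s', ENNReal.ofReal (‖s'.grad - v‖ ^ 2)
        ∂((Measure.pi fun _ : Fin m => ρ).map (batchMove lmo T s g n X))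
      ≤ ENNReal.ofReal (‖g - v + ∫ ω, X ω ∂ρ‖ ^ 2 + (1 / (m : ℝ)) * ∫ ω, ‖X ω‖ ^ 2 ∂ρ) := by
  have hmeas : Measurable fun s' : State d => ENNReal.ofReal (‖s'.grad - v‖ ^ 2) :=
    ENNReal.measurable_ofReal.comp ((State.measurable_grad.sub measurable_const).norm.pow_const 2)
  rw [lintegral_map' hmeas.aemeasurable (aemeasurable_batchMove hlmo
    hX.aestronglyMeasurable.aemeasurable T s g n)]
  refine le_trans (le_of_eq (lintegral_congr fun b => ?_)) (lintegral_norm_sq_average hm hX (g - v))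
  change ENNReal.ofReal (‖g + (1 / (m : ℝ)) • ∑ k, X (b k) - v‖ ^ 2) = _
  rw [add_sub_right_comm]

end Iteration

section Bind

variable {α β : Type*} [MeasurableSpace α] [MeasurableSpace β] {μ : Measure α} {κ : α → Measure β}

lemma isProbabilityMeasure_bind [IsProbabilityMeasure μ] (hκ : AEMeasurable κ μ)
    (h : ∀ᵐ a ∂μ, IsProbabilityMeasure (κ a)) : IsProbabilityMeasure (μ.bind κ) := by
  refine ⟨?_⟩
  rw [Measure.bind_apply MeasurableSet.univ hκ, lintegral_congr_ae (g := fun _ => 1)]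
  · simp
  · filter_upwards [h] with a ha
    exact measure_univ

lemma ae_bind_of_ae_ae (hκ : AEMeasurable κ μ) {p : β → Prop} (hp : MeasurableSet {b | p b})
    (h : ∀ᵐ a ∂μ, ∀ᵐ b ∂κ a, p b) : ∀ᵐ b ∂μ.bind κ, p b := by
  have hc : MeasurableSet {b | ¬ p b} := hp.compl
  rw [ae_iff, Measure.bind_apply hc hκ, lintegral_congr_ae (g := fun _ => 0)]
  · simp
  · filter_upwards [h] with a ha
    exact ae_iff.1 ha

end Bind

/-! ### The iteration of SCG++ from a state whose iterates lie in `K` -/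

namespace StochObjective

variable {d : ℕ} {Z : Type*} [MeasurableSpace Z] {O : StochObjective d Z} {K : Set (Space d)}
  {B G L R τ : ℝ} {hv : Space d → Z → Space d → Space d} {lmo : Space d → Space d}
  {T M₀ M cost t : ℕ}

/-- States with both iterates in `K`, at distance at most `R`. -/
def goodStates (K : Set (Space d)) (R : ℝ) : Set (State d) :=
  {s | s.prev ∈ K ∧ s.cur ∈ K ∧ ‖s.cur - s.prev‖ ≤ R}

lemma measurableSet_goodStates (hK : MeasurableSet K) (R : ℝ) :
    MeasurableSet (goodStates K R) :=
  (State.measurable_prev hK).inter ((State.measurable_cur hK).inter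
    (measurableSet_le (State.measurable_cur.sub State.measurable_prev).norm measurable_const))

lemma iteration_zero (s : State d) :
    iteration O hv cost lmo T M₀ M 0 s
      = (Measure.pi fun _ : Fin M₀ => O.sampleLaw s.cur).map
          (batchMove lmo T s 0 (s.calls + M₀) (O.gradEst s.cur)) := by
  simp only [iteration, if_true, minibatch_eq, mul_one]
  congr 1
  funext b
  rw [batchMove, zero_add]

lemma iteration_of_ne_zero (ht : t ≠ 0) (s : State d) :
    iteration O hv cost lmo T M₀ M t s
      = (Measure.pi fun _ : Fin M => O.pathLaw s.prev s.cur).map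
          (batchMove lmo T s s.grad (s.calls + M * cost)
            fun q => hv (pathPoint s.prev s.cur q.1) q.2 (s.cur - s.prev)) := by
  simp only [iteration, if_neg ht, minibatch_eq]
  rfl

lemma measurable_clamped_oracle (hK : Convex ℝ K)
    (hhv : Measurable fun p : (K × Z) × Metric.closedBall (0 : Space d) R => hv p.1.1 p.1.2 p.2) :
    Measurable fun p : goodStates K R × (ℝ × Z) =>
      hv (pathPoint p.1.1.prev p.1.1.cur (clamp p.2.1)) p.2.2 (p.1.1.cur - p.1.1.prev) := by
  have hprev : Measurable fun p : goodStates K R × (ℝ × Z) => p.1.1.prev :=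
    State.measurable_prev.comp (measurable_subtype_coe.comp measurable_fst)
  have hcur : Measurable fun p : goodStates K R × (ℝ × Z) => p.1.1.cur :=
    State.measurable_cur.comp (measurable_subtype_coe.comp measurable_fst)
  have ha : Measurable fun p : goodStates K R × (ℝ × Z) => clamp p.2.1 :=
    measurable_clamp.comp measurable_snd.fst
  have h1 : Measurable fun p : goodStates K R × (ℝ × Z) =>
      (⟨pathPoint p.1.1.prev p.1.1.cur (clamp p.2.1),
        segment_mem hK p.1.2.1 p.1.2.2.1 (clamp_mem _)⟩ : K) :=
    Measurable.subtype_mk (((measurable_const.sub ha).smul hprev).add (ha.smul hcur))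
  have h2 : Measurable fun p : goodStates K R × (ℝ × Z) =>
      (⟨p.1.1.cur - p.1.1.prev, by simpa using p.1.2.2.2⟩ : Metric.closedBall (0 : Space d) R) :=
    Measurable.subtype_mk (hcur.sub hprev)
  have h3 : Measurable fun p : goodStates K R × (ℝ × Z) => p.2.2 := measurable_snd.snd
  have h4 := (h1.prodMk h3).prodMk h2
  have h5 := hhv.comp h4
  exact h5

lemma ae_pi_of_ae {Ω : Type*} [MeasurableSpace Ω] {ρ : Measure Ω} [IsProbabilityMeasure ρ] {m : ℕ}
    {p : Ω → Prop} (hp : ∀ᵐ ω ∂ρ, p ω) :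
    ∀ᵐ b : Fin m → Ω ∂(Measure.pi fun _ => ρ), ∀ k, p (b k) :=
  ae_all_iff.2 fun k =>
    (measurePreserving_eval (fun _ : Fin m => ρ) k).quasiMeasurePreserving.ae hp

namespace ApproxHessVec

variable (ha : O.ApproxHessVec K hv R τ) (h : O.RegularOn K B G L) [SigmaFinite O.base]
include ha h

lemma aemeasurable_iteration (hKm : MeasurableSet K) (hlmo : Measurable lmo) (ht : t ≠ 0)
    {μ : Measure (State d)} (hμ : ∀ᵐ s ∂μ, s ∈ goodStates K R) :
    AEMeasurable (iteration O hv cost lmo T M₀ M t) μ := by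
  refine aemeasurable_of_measurable_subtype (measurableSet_goodStates hKm R) hμ ?_
  have hprob : ∀ s : goodStates K R, IsProbabilityMeasure (O.pathLaw s.1.prev s.1.cur) :=
    fun s => isProbabilityMeasure_pathLaw h.convex h.isProbability h.measurable_dens s.2.1 s.2.2.1
  have heq : (fun s : goodStates K R => iteration O hv cost lmo T M₀ M t s)
      = fun s => (Measure.pi fun _ : Fin M => O.pathLaw s.1.prev s.1.cur).map
          (batchMove lmo T s.1 s.1.grad (s.1.calls + M * cost) fun q =>
            hv (pathPoint s.1.prev s.1.cur (clamp q.1)) q.2 (s.1.cur - s.1.prev)) := by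
    funext s
    rw [iteration_of_ne_zero ht]
    refine Measure.map_congr ?_
    filter_upwards [ae_pi_of_ae (m := M)
      (ae_pathLaw_mem_Icc h.measurable_dens s.1.prev s.1.cur)] with b hb
    simp only [batchMove]
    congr 3
    exact Finset.sum_congr rfl fun k _ => by rw [clamp_of_mem (hb k)]
  rw [heq]
  have hκ : Measurable fun s : goodStates K R => O.pathLaw s.1.prev s.1.cur := by
    have h1 : Measurable fun s : goodStates K R => (s.1.prev, s.1.cur) :=
      (State.measurable_prev.comp measurable_subtype_coe).prodMk
        (State.measurable_cur.comp measurable_subtype_coe)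
    have h2 := (measurable_pathLaw h.measurable_dens).comp h1
    exact h2
  refine measurable_map_pi_const hκ ?_
  have hX := measurable_clamped_oracle h.convex ha.measurable
  have hXk : ∀ k : Fin M, Measurable fun p : goodStates K R × (Fin M → ℝ × Z) =>
      hv (pathPoint p.1.1.prev p.1.1.cur (clamp (p.2 k).1)) (p.2 k).2
        (p.1.1.cur - p.1.1.prev) := by
    intro k
    have h1 : Measurable fun p : goodStates K R × (Fin M → ℝ × Z) => (p.1, p.2 k) :=
      measurable_fst.prodMk ((measurable_pi_apply k).comp measurable_snd)
    have h2 := hX.comp h1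
    exact h2
  have hsum := Finset.measurable_sum Finset.univ fun k _ => hXk k
  have hs : Measurable fun p : goodStates K R × (Fin M → ℝ × Z) => p.1.1 :=
    measurable_subtype_coe.comp measurable_fst
  have hg : Measurable fun p : goodStates K R × (Fin M → ℝ × Z) => p.1.1.grad :=
    State.measurable_grad.comp hs
  have hc : Measurable fun p : goodStates K R × (Fin M → ℝ × Z) => p.1.1.calls + M * cost :=
    (State.measurable_calls.comp hs).add measurable_const
  have hav := hg.add (hsum.const_smul (1 / (M : ℝ)))
  have := hs.prodMk (hav.prodMk hc)
  have hmove := (measurable_move hlmo T).comp this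
  exact hmove

lemma isStep_iteration (hlmo : Measurable lmo) (ht : t ≠ 0) (hτ : 0 ≤ τ) {s : State d}
    (hs : s ∈ goodStates K R) :
    IsStep lmo T (M * cost) s (iteration O hv cost lmo T M₀ M t s) := by
  obtain ⟨hp, hc, hR⟩ := hs
  have := isProbabilityMeasure_pathLaw h.convex h.isProbability h.measurable_dens hp hc
  rw [iteration_of_ne_zero ht]
  exact isStep_batchMove hlmo (ha.memLp_path h hp hc hR hτ).1.aestronglyMeasurable.aemeasurable
    T s s.grad (M * cost)

lemma lintegral_iteration_le (hlmo : Measurable lmo) (ht : t ≠ 0) (hτ : 0 ≤ τ) (hM : 0 < M)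
    {s : State d} (hs : s ∈ goodStates K R) :
    ∫⁻ s', ENNReal.ofReal (‖s'.grad - O.meanGrad s.cur‖ ^ 2)
        ∂iteration O hv cost lmo T M₀ M t s
      ≤ ENNReal.ofReal ((‖s.grad - O.meanGrad s.prev‖ + τ * R) ^ 2
          + (1 / (M : ℝ)) * ((Lbar B G L + τ) * R) ^ 2) := by
  obtain ⟨hp, hc, hR⟩ := hs
  have := isProbabilityMeasure_pathLaw h.convex h.isProbability h.measurable_dens hp hc
  obtain ⟨m1, m2⟩ := ha.memLp_path h hp hc hR hτ
  have hbias := ha.norm_integral_path_sub_le h hp hc hR hτ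
  rw [iteration_of_ne_zero ht]
  refine (lintegral_batchMove_le hlmo hM m1 T s s.grad (O.meanGrad s.cur) _).trans
    (ENNReal.ofReal_le_ofReal (add_le_add ?_ ?_))
  · refine pow_le_pow_left₀ (norm_nonneg _) ?_ 2
    have hsplit : s.grad - O.meanGrad s.cur
          + ∫ q, hv (pathPoint s.prev s.cur q.1) q.2 (s.cur - s.prev) ∂O.pathLaw s.prev s.cur
        = (s.grad - O.meanGrad s.prev)
          + (∫ q, hv (pathPoint s.prev s.cur q.1) q.2 (s.cur - s.prev) ∂O.pathLaw s.prev s.cur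
            - (O.meanGrad s.cur - O.meanGrad s.prev)) := by abel
    rw [hsplit]
    exact (norm_add_le _ _).trans (add_le_add_right
      (hbias.trans (mul_le_mul_of_nonneg_left hR hτ)) _)
  · refine mul_le_mul_of_nonneg_left (m2.trans ?_) (by positivity)
    exact pow_le_pow_left₀ (mul_nonneg (add_nonneg (Lbar_nonneg _ _ _) hτ) (norm_nonneg _))
      (mul_le_mul_of_nonneg_left hR (add_nonneg (Lbar_nonneg _ _ _) hτ)) 2

end ApproxHessVec

namespace RegularOn

variable (h : O.RegularOn K B G L)
include h

lemma isStep_iteration_zero (hlmo : Measurable lmo) {s : State d} (hs : s.cur ∈ K) :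
    IsStep lmo T M₀ s (iteration O hv cost lmo T M₀ M 0 s) := by
  have := h.isProbability _ hs
  rw [iteration_zero]
  exact isStep_batchMove hlmo (h.measurable_gradEst_right hs).aemeasurable T s 0 M₀

lemma lintegral_iteration_zero_le (hlmo : Measurable lmo) (hM₀ : 0 < M₀) {s : State d}
    (hs : s.cur ∈ K) :
    ∫⁻ s', ENNReal.ofReal (‖s'.grad - O.meanGrad s.cur‖ ^ 2) ∂iteration O hv cost lmo T M₀ M 0 s
      ≤ ENNReal.ofReal ((1 / (M₀ : ℝ)) * ((1 + B) ^ 2 * G ^ 2)) := by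
  have := h.isProbability _ hs
  rw [iteration_zero]
  refine (lintegral_batchMove_le hlmo hM₀ (h.memLp_gradEst hs) T s 0 (O.meanGrad s.cur) _).trans
    (ENNReal.ofReal_le_ofReal ?_)
  have : (0 : Space d) - O.meanGrad s.cur + ∫ z, O.gradEst s.cur z ∂O.sampleLaw s.cur = 0 := by
    rw [meanGrad]
    abel
  rw [this, norm_zero, zero_pow two_ne_zero, zero_add]
  exact mul_le_mul_of_nonneg_left (h.integral_gradEst_sq_le hs) (by positivity)

end RegularOn

end StochObjective

section Convergence

variable {d : ℕ} {C : Set (Space d)} {lmo : Space d → Space d} {T t n : ℕ}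

/-- States that can occur before iteration `t ≥ 1`, after `n` oracle calls. -/
def reachable (C : Set (Space d)) (lmo : Space d → Space d) (T t n : ℕ) : Set (State d) :=
  {s | s.prev ∈ hull0 C ∧ s.cur ∈ (fun c => ((t : ℝ) / T) • c) '' C ∧
    s.cur = s.prev + (1 / (T : ℝ)) • lmo s.grad ∧ s.calls = n}

lemma measurableSet_reachable (hC : IsCompact C) (hK : IsCompact (hull0 C)) (hlmo : Measurable lmo) :
    MeasurableSet (reachable C lmo T t n) := by
  have h1 : IsCompact ((fun c : Space d => ((t : ℝ) / T) • c) '' C) := hC.image (by fun_prop)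
  have hr : Measurable fun s' : State d => s'.prev + (1 / (T : ℝ)) • lmo s'.grad := by
    unfold State.prev State.grad
    fun_prop
  exact (State.measurable_prev hK.measurableSet).inter
    ((State.measurable_cur h1.measurableSet).inter
      ((measurableSet_eq_fun State.measurable_cur hr).inter
        (measurableSet_eq_fun State.measurable_calls measurable_const)))

lemma cur_mem_hull0 (htT : t ≤ T) {s : State d}
    (hs : s.cur ∈ (fun c => ((t : ℝ) / T) • c) '' C) : s.cur ∈ hull0 C := by
  obtain ⟨c, hc, hcs⟩ := hs
  rw [← hcs]
  exact smul_mem_hull0 (by positivity)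
    (div_le_one_of_le₀ (by exact_mod_cast htT) (by positivity)) hc

lemma reachable_subset_goodStates (hK : IsCompact (hull0 C)) (hlmo : IsLinearOracle C lmo)
    (htT : t ≤ T) :
    reachable C lmo T t n ⊆ StochObjective.goodStates (hull0 C) (1 / (T : ℝ) * diameter C) := by
  rintro s ⟨h1, h2, h3, -⟩
  refine ⟨h1, cur_mem_hull0 htT h2, ?_⟩
  rw [h3, add_sub_cancel_left, norm_smul, Real.norm_of_nonneg (by positivity)]
  exact mul_le_mul_of_nonneg_left (norm_le_diameter hK (subset_hull0 (hlmo.mem _))) (by positivity)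

lemma IsStep.ae_reachable (hCconv : Convex ℝ C)
    (hlmo : IsLinearOracle C lmo) {m : ℕ} {s : State d} {η : Measure (State d)}
    (hη : IsStep lmo T m s η) (htT : t ≤ T) (hT : 0 < T)
    (hs : s.cur ∈ (fun c => ((t : ℝ) / T) • c) '' C) (hn : s.calls = n) :
    ∀ᵐ s' ∂η, s' ∈ reachable C lmo T (t + 1) (n + m) := by
  filter_upwards [hη.prev_eq, hη.cur_eq, hη.calls_eq] with s' h1 h2 h3
  refine ⟨h1 ▸ cur_mem_hull0 htT hs, ?_, h2, by rw [h3, hn]⟩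
  obtain ⟨c, hc, hcs⟩ := hs
  have hT' : (T : ℝ) ≠ 0 := by exact_mod_cast hT.ne'
  have ht' : (t : ℝ) + 1 ≠ 0 := by positivity
  refine ⟨((t : ℝ) / (t + 1)) • c + (1 / ((t : ℝ) + 1)) • lmo s'.grad,
    hCconv hc (hlmo.mem _) (by positivity) (by positivity) (by field_simp), ?_⟩
  rw [h2, h1, ← hcs]
  simp only [smul_add, smul_smul]
  push_cast
  congr 2 <;> field_simp

variable {F : Space d → ℝ} {φ : Space d → Space d} {Λ : ℝ}

/-- Progress of one Frank–Wolfe-type step with the estimate `s.grad` of the gradient. -/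
lemma SmoothOn.progress {u : Fin d → ℝ} (hF : SmoothOn F φ (hull0 C) Λ) (hΛ : 0 ≤ Λ)
    (hK : IsCompact (hull0 C)) (hbox : hull0 C ⊆ box u) (hint : (interior (hull0 C)).Nonempty)
    (hmono : IsMonotoneOn F (box u)) (hDR : IsDRSubmodularOn F (box u))
    (hlmo : IsLinearOracle C lmo) (htT : t ≤ T) {xs : Space d} (hxs : xs ∈ C) {s : State d}
    (hs : s ∈ reachable C lmo T t n) :
    (1 - 1 / (T : ℝ)) * F s.prev + 1 / (T : ℝ) * F xs
      - 1 / (T : ℝ) * diameter C * ‖s.grad - φ s.prev‖ - Λ / 2 * (1 / (T : ℝ) * diameter C) ^ 2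
      ≤ F s.cur := by
  obtain ⟨h1, h2, h3, -⟩ := hs
  have hcur := cur_mem_hull0 htT h2
  set v := lmo s.grad with hv
  have hvC : v ∈ C := hlmo.mem _
  have hT0 : 0 ≤ 1 / (T : ℝ) := by positivity
  have htay := (abs_le.1 (hF.taylor _ h1 _ hcur)).1
  rw [h3, add_sub_cancel_left, ← h3, inner_smul_right, norm_smul, Real.norm_of_nonneg hT0] at htay
  have hquad : Λ / 2 * (1 / (T : ℝ) * ‖v‖) ^ 2 ≤ Λ / 2 * (1 / (T : ℝ) * diameter C) ^ 2 :=
    mul_le_mul_of_nonneg_left (pow_le_pow_left₀ (by positivity)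
      (mul_le_mul_of_nonneg_left (norm_le_diameter hK (subset_hull0 hvC)) hT0) 2) (by positivity)
  have hmax : inner ℝ xs s.grad ≤ inner ℝ v s.grad := hlmo.isMax s.grad hxs
  have hfo := hF.apply_sub_le_inner hbox convex_hull0 hint hmono hDR h1 (hbox (subset_hull0 hxs))
  have herr : inner ℝ (s.grad - φ s.prev) (v - xs) ≤ ‖s.grad - φ s.prev‖ * diameter C :=
    (real_inner_le_norm _ _).trans (mul_le_mul_of_nonneg_left
      (norm_sub_le_diameter hK (subset_hull0 hvC) (subset_hull0 hxs)) (norm_nonneg _))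
  rw [inner_sub_right, inner_sub_left, inner_sub_left, real_inner_comm v, real_inner_comm xs] at herr
  have hkey : F xs - F s.prev - ‖s.grad - φ s.prev‖ * diameter C ≤ inner ℝ (φ s.prev) v := by
    linarith
  have := mul_le_mul_of_nonneg_left hkey hT0
  linarith

/-- The law of the state before iteration `t ≥ 1`: reachability and the root mean square error `q`
of the gradient estimate. -/
structure RunInvariant (φ : Space d → Space d) (C : Set (Space d)) (lmo : Space d → Space d)
    (T t n : ℕ) (q : ℝ) (μ : Measure (State d)) : Prop where
  isProbability : IsProbabilityMeasure μ
  reachable : ∀ᵐ s ∂μ, s ∈ reachable C lmo T t n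
  error_le : ∫⁻ s, ENNReal.ofReal (‖s.grad - φ s.prev‖ ^ 2) ∂μ ≤ ENNReal.ofReal (q ^ 2)

lemma measurable_error (hφ : Measurable φ) :
    Measurable fun s : State d => s.grad - φ s.prev :=
  State.measurable_grad.sub (hφ.comp State.measurable_prev)

variable {q : ℝ} {μ : Measure (State d)}

lemma RunInvariant.integral_error_le (hμ : RunInvariant φ C lmo T t n q μ) (hφ : Measurable φ)
    (hq : 0 ≤ q) :
    MemLp (fun s : State d => s.grad - φ s.prev) 2 μ ∧
      ∫ s : State d, ‖s.grad - φ s.prev‖ ^ 2 ∂μ ≤ q ^ 2 ∧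
      ∫ s : State d, ‖s.grad - φ s.prev‖ ∂μ ≤ q := by
  have := hμ.isProbability
  obtain ⟨h1, h2⟩ := memLp_two_of_lintegral_sq_le (measurable_error hφ).aestronglyMeasurable
    (sq_nonneg q) hμ.error_le
  exact ⟨h1, h2, integral_le_of_integral_sq_le h1.norm hq h2⟩

lemma lintegral_shifted_error_le (hμ : RunInvariant φ C lmo T t n q μ) (hφ : Measurable φ)
    (hq : 0 ≤ q) {β V : ℝ} (hβ : 0 ≤ β) (hV : 0 ≤ V) :
    ∫⁻ s, ENNReal.ofReal ((‖s.grad - φ s.prev‖ + β) ^ 2 + V) ∂μ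
      ≤ ENNReal.ofReal ((q + β) ^ 2 + V) := by
  have := hμ.isProbability
  obtain ⟨h1, h2, h3⟩ := hμ.integral_error_le hφ hq
  have i1 : Integrable (fun s : State d => ‖s.grad - φ s.prev‖) μ := h1.norm.integrable one_le_two
  have i2 : Integrable (fun s : State d => ‖s.grad - φ s.prev‖ ^ 2) μ := h1.norm.integrable_sq
  have j1 : Integrable (fun s : State d => ‖s.grad - φ s.prev‖ ^ 2
      + 2 * β * ‖s.grad - φ s.prev‖) μ := i2.add (i1.const_mul _)
  have j2 : Integrable (fun s : State d => ‖s.grad - φ s.prev‖ ^ 2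
      + 2 * β * ‖s.grad - φ s.prev‖ + (β ^ 2 + V)) μ := j1.add (integrable_const _)
  have hexp : ∀ s : State d, (‖s.grad - φ s.prev‖ + β) ^ 2 + V = ‖s.grad - φ s.prev‖ ^ 2
      + 2 * β * ‖s.grad - φ s.prev‖ + (β ^ 2 + V) := fun s => by ring
  simp_rw [hexp]
  rw [← ofReal_integral_eq_lintegral_ofReal j2
    (Filter.Eventually.of_forall fun s => by positivity)]
  refine ENNReal.ofReal_le_ofReal ?_
  rw [integral_add j1 (integrable_const _), integral_add i2 (i1.const_mul _), integral_const_mul,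
    integral_const, probReal_univ, one_smul]
  have := mul_le_mul_of_nonneg_left h3 (show 0 ≤ 2 * β by positivity)
  linarith

lemma integrable_comp_of_ae_mem (hFm : Measurable F) {B : ℝ} {K : Set (Space d)}
    (hB : ∀ x ∈ K, |F x| ≤ B) [IsProbabilityMeasure μ] {f : State d → Space d} (hf : Measurable f)
    (hfK : ∀ᵐ s ∂μ, f s ∈ K) : Integrable (fun s => F (f s)) μ := by
  refine Integrable.of_bound (hFm.comp hf).aestronglyMeasurable B ?_
  filter_upwards [hfK] with s hs
  exact hB _ hs

/-- Expected progress of one iteration. -/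
lemma RunInvariant.integral_progress {u : Fin d → ℝ} (hF : SmoothOn F φ (hull0 C) Λ) (hΛ : 0 ≤ Λ)
    (hK : IsCompact (hull0 C)) (hbox : hull0 C ⊆ box u) (hint : (interior (hull0 C)).Nonempty)
    (hmono : IsMonotoneOn F (box u)) (hDR : IsDRSubmodularOn F (box u))
    (hlmo : IsLinearOracle C lmo) (htT : t ≤ T) {xs : Space d} (hxs : xs ∈ C)
    (hFm : Measurable F) (hφ : Measurable φ) {B : ℝ} (hB : ∀ x ∈ hull0 C, |F x| ≤ B)
    (hμ : RunInvariant φ C lmo T t n q μ) (hq : 0 ≤ q) :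
    (1 - 1 / (T : ℝ)) * ∫ s : State d, F s.prev ∂μ + 1 / (T : ℝ) * F xs
      - 1 / (T : ℝ) * diameter C * q - Λ / 2 * (1 / (T : ℝ) * diameter C) ^ 2
      ≤ ∫ s : State d, F s.cur ∂μ := by
  have := hμ.isProbability
  obtain ⟨h1, -, h3⟩ := hμ.integral_error_le hφ hq
  have i1 : Integrable (fun s : State d => ‖s.grad - φ s.prev‖) μ := h1.norm.integrable one_le_two
  have iprev : Integrable (fun s : State d => F s.prev) μ :=
    integrable_comp_of_ae_mem hFm hB State.measurable_prev (hμ.reachable.mono fun s hs => hs.1)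
  have icur : Integrable (fun s : State d => F s.cur) μ :=
    integrable_comp_of_ae_mem hFm hB State.measurable_cur
      (hμ.reachable.mono fun s hs => cur_mem_hull0 htT hs.2.1)
  have j1 : Integrable (fun s : State d => (1 - 1 / (T : ℝ)) * F s.prev + 1 / (T : ℝ) * F xs) μ :=
    (iprev.const_mul _).add (integrable_const _)
  have j2 : Integrable (fun s : State d => (1 - 1 / (T : ℝ)) * F s.prev + 1 / (T : ℝ) * F xs
      - 1 / (T : ℝ) * diameter C * ‖s.grad - φ s.prev‖) μ := j1.sub (i1.const_mul _)
  have hle := integral_mono_ae (j2.sub (integrable_const (Λ / 2 * (1 / (T : ℝ) * diameter C) ^ 2)))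
    icur (hμ.reachable.mono fun s hs =>
      hF.progress hΛ hK hbox hint hmono hDR hlmo htT hxs hs)
  have hsub := integral_sub j2 (integrable_const (μ := μ) (Λ / 2 * (1 / (T : ℝ) * diameter C) ^ 2))
  simp only [Pi.sub_apply] at hle
  rw [hsub, integral_sub j1 (i1.const_mul _),
    integral_add (iprev.const_mul _) (integrable_const _), integral_const_mul, integral_const_mul,
    integral_const_mul, integral_const, integral_const,
    probReal_univ, one_smul, one_smul] at hle
  have := mul_le_mul_of_nonneg_left h3
    (show 0 ≤ 1 / (T : ℝ) * diameter C by unfold diameter; positivity)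
  linarith

lemma integral_prev_bind {κ : State d → Measure (State d)} (hκ : AEMeasurable κ μ)
    (hstep : ∀ᵐ s ∂μ, ∃ m, IsStep lmo T m s (κ s)) (hFm : Measurable F) :
    ∫ s : State d, F s.prev ∂(μ.bind κ) = ∫ s : State d, F s.cur ∂μ := by
  have hmap : (μ.bind κ).map State.prev = μ.map State.cur := by
    ext A hA
    rw [Measure.map_apply State.measurable_prev hA, Measure.map_apply State.measurable_cur hA,
      Measure.bind_apply (State.measurable_prev hA) hκ,
      ← lintegral_indicator_one (State.measurable_cur hA)]
    refine lintegral_congr_ae ?_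
    filter_upwards [hstep] with s ⟨m, hs⟩
    have := hs.isProbability
    by_cases hsA : s.cur ∈ A
    · have h1 : ∀ᵐ s' ∂κ s, s' ∈ State.prev ⁻¹' A := hs.prev_eq.mono fun s' h => by
        simpa [Set.mem_preimage, h] using hsA
      rw [Set.indicator_of_mem (by exact hsA), Pi.one_apply]
      exact (mem_ae_iff_prob_eq_one (State.measurable_prev hA)).1 h1
    · have h1 : ∀ᵐ s' ∂κ s, s' ∉ State.prev ⁻¹' A := hs.prev_eq.mono fun s' h => by
        simpa [Set.mem_preimage, h] using hsA
      rw [Set.indicator_of_notMem (by exact hsA)]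
      exact measure_eq_zero_iff_ae_notMem.2 h1
  have hs := hFm.stronglyMeasurable.aestronglyMeasurable (μ := μ.map State.cur)
  have hs' := hFm.stronglyMeasurable.aestronglyMeasurable (μ := (μ.bind κ).map State.prev)
  rw [← integral_map State.measurable_cur.aemeasurable hs, ← hmap,
    integral_map State.measurable_prev.aemeasurable hs']

lemma RunInvariant.bind [IsProbabilityMeasure μ] (hC : IsCompact C) (hCconv : Convex ℝ C)
    (hK : IsCompact (hull0 C)) (hlmo : IsLinearOracle C lmo) (htT : t ≤ T) (hT : 0 < T)
    (hφ : Measurable φ) {m : ℕ} {κ : State d → Measure (State d)} (hκ : AEMeasurable κ μ)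
    (hstep : ∀ᵐ s ∂μ, IsStep lmo T m s (κ s))
    (hcur : ∀ᵐ s : State d ∂μ, s.cur ∈ (fun c => ((t : ℝ) / T) • c) '' C ∧ s.calls = n)
    (herr : ∫⁻ s : State d, ∫⁻ s' : State d, ENNReal.ofReal (‖s'.grad - φ s.cur‖ ^ 2) ∂κ s ∂μ
      ≤ ENNReal.ofReal (q ^ 2)) :
    RunInvariant φ C lmo T (t + 1) (n + m) q (μ.bind κ) := by
  refine ⟨isProbabilityMeasure_bind hκ (hstep.mono fun s hs => hs.isProbability),
    ae_bind_of_ae_ae hκ (measurableSet_reachable hC hK hlmo.measurable) ?_, ?_⟩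
  · filter_upwards [hstep, hcur] with s hs hs'
    exact hs.ae_reachable hCconv hlmo htT hT hs'.1 hs'.2
  · have hm : Measurable fun s : State d => ENNReal.ofReal (‖s.grad - φ s.prev‖ ^ 2) :=
      ENNReal.measurable_ofReal.comp ((measurable_error hφ).norm.pow_const 2)
    rw [Measure.lintegral_bind hκ hm.aemeasurable]
    refine le_trans (le_of_eq (lintegral_congr_ae ?_)) herr
    filter_upwards [hstep] with s hs
    refine lintegral_congr_ae ?_
    filter_upwards [hs.prev_eq] with s' hs'
    rw [hs']

end Convergence

section Run

variable {d : ℕ} {C : Set (Space d)} {lmo : Space d → Space d} {Z : Type*} [MeasurableSpace Z]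
  {O : StochObjective d Z} {B G L τ : ℝ} {hv : Space d → Z → Space d → Space d}
  {T M₀ M cost : ℕ}

/-- The gradient of the objective on `conv(C ∪ {0})`, extended by zero. -/
def gradOnHull (O : StochObjective d Z) (C : Set (Space d)) : Space d → Space d :=
  (hull0 C).indicator O.meanGrad

lemma SmoothOn.gradOnHull {F : Space d → ℝ} {Λ : ℝ} (h : SmoothOn F O.meanGrad (hull0 C) Λ) :
    SmoothOn F (gradOnHull O C) (hull0 C) Λ := by
  refine ⟨fun x hx y hy => ?_, fun x hx y hy => ?_⟩
  · rw [SCGpp.gradOnHull, Set.indicator_of_mem hx]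
    exact h.taylor x hx y hy
  · rw [SCGpp.gradOnHull, Set.indicator_of_mem hx, Set.indicator_of_mem hy]
    exact h.lipschitz x hx y hy

lemma SmoothOn.measurable_gradOnHull {F : Space d → ℝ} {Λ : ℝ}
    (h : SmoothOn F O.meanGrad (hull0 C) Λ) (hK : IsCompact (hull0 C)) :
    Measurable (SCGpp.gradOnHull O C) := by
  classical
  rw [SCGpp.gradOnHull, ← Set.piecewise_eq_indicator]
  exact h.continuousOn_grad.measurable_piecewise continuousOn_const hK.measurableSet

/-- Bound on the root mean square error of the gradient estimate after `t` corrections, from the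
second moments of the initial estimate and of the corrections and the bias of the latter. -/
def errorBound (V₀ V β : ℝ) (t : ℕ) : ℝ := Real.sqrt (V₀ + t * V) + t * β

lemma errorBound_nonneg {V₀ V β : ℝ} (hβ : 0 ≤ β) (t : ℕ) : 0 ≤ errorBound V₀ V β t :=
  add_nonneg (Real.sqrt_nonneg _) (by positivity)

lemma errorBound_succ {V₀ V β : ℝ} (hV₀ : 0 ≤ V₀) (hV : 0 ≤ V) (hβ : 0 ≤ β) (t : ℕ) :
    (errorBound V₀ V β t + β) ^ 2 + V ≤ errorBound V₀ V β (t + 1) ^ 2 := by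
  unfold errorBound
  push_cast
  have h1 : 0 ≤ V₀ + t * V := by positivity
  have h2 : 0 ≤ V₀ + (t + 1) * V := by positivity
  have h3 := Real.sq_sqrt h1
  have h4 := Real.sq_sqrt h2
  have h5 : Real.sqrt (V₀ + t * V) ≤ Real.sqrt (V₀ + (t + 1) * V) :=
    Real.sqrt_le_sqrt (by linarith)
  have h6 := mul_le_mul_of_nonneg_right h5 (show 0 ≤ 2 * (((t : ℝ) + 1) * β) by positivity)
  have e1 : (Real.sqrt (V₀ + t * V) + t * β + β) ^ 2 = Real.sqrt (V₀ + t * V) ^ 2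
      + Real.sqrt (V₀ + t * V) * (2 * (((t : ℝ) + 1) * β)) + (((t : ℝ) + 1) * β) ^ 2 := by ring
  have e2 : (Real.sqrt (V₀ + (t + 1) * V) + (t + 1) * β) ^ 2 = Real.sqrt (V₀ + (t + 1) * V) ^ 2
      + Real.sqrt (V₀ + (t + 1) * V) * (2 * (((t : ℝ) + 1) * β)) + (((t : ℝ) + 1) * β) ^ 2 := by
    ring
  rw [e1, e2, h3, h4]
  linarith

lemma errorBound_mono {V₀ V β : ℝ} (hV : 0 ≤ V) (hβ : 0 ≤ β) {s t : ℕ} (hst : s ≤ t) :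
    errorBound V₀ V β s ≤ errorBound V₀ V β t := by
  have h : (s : ℝ) ≤ t := by exact_mod_cast hst
  unfold errorBound
  gcongr

/-- Hypotheses common to the exact and the finite-difference run. -/
structure RunSetting (O : StochObjective d Z) (C : Set (Space d)) (u : Fin d → ℝ) (B G L : ℝ)
    (lmo : Space d → Space d) (hv : Space d → Z → Space d → Space d) (T M₀ M : ℕ) (τ : ℝ) :
    Prop where
  isCompact : IsCompact C
  convex : Convex ℝ C
  nonempty : C.Nonempty
  subset_box : C ⊆ box u
  integrable : ∀ x ∈ hull0 C, Integrable (O.val x) (O.sampleLaw x)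
  monotone : IsMonotoneOn O.objective (box u)
  drSubmodular : IsDRSubmodularOn O.objective (box u)
  zero_le : 0 ≤ O.objective 0
  regular : O.RegularOn (hull0 C) B G L
  oracle : IsLinearOracle C lmo
  approx : O.ApproxHessVec (hull0 C) hv (1 / (T : ℝ) * diameter C) τ
  nonneg : 0 ≤ τ
  T_pos : 0 < T
  M₀_pos : 0 < M₀
  M_pos : 0 < M

namespace RunSetting

variable {u : Fin d → ℝ} (h : RunSetting O C u B G L lmo hv T M₀ M τ) [SigmaFinite O.base]
include h

omit [SigmaFinite O.base] in
lemma isCompact_hull0 : IsCompact (hull0 C) := SCGpp.isCompact_hull0 h.convex h.isCompact h.nonempty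

lemma smoothOn : SmoothOn O.objective O.meanGrad (hull0 C) (Lbar B G L) :=
  h.regular.smoothOn h.integrable

lemma measurable_grad : Measurable (gradOnHull O C) :=
  h.smoothOn.measurable_gradOnHull h.isCompact_hull0

lemma runInvariant_one :
    RunInvariant (gradOnHull O C) C lmo T 1 M₀
      (errorBound ((1 / (M₀ : ℝ)) * ((1 + B) ^ 2 * G ^ 2)) 0 0 0)
      (runLaw O hv cost lmo T M₀ M 1) := by
  have hae : ∀ {p : State d → Prop}, p (0, 0, 0, 0) →
      ∀ᵐ s ∂(Measure.dirac (0, 0, 0, 0) : Measure (State d)), p s := fun hp => by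
    rw [ae_dirac_eq]
    exact hp
  have hcur : State.cur ((0, 0, 0, 0) : State d) ∈ hull0 C := zero_mem_hull0
  have := RunInvariant.bind (μ := Measure.dirac ((0, 0, 0, 0) : State d)) (t := 0) (n := 0)
    (m := M₀) (q := errorBound ((1 / (M₀ : ℝ)) * ((1 + B) ^ 2 * G ^ 2)) 0 0 0) (T := T)
    (κ := iteration O hv cost lmo T M₀ M 0)
    h.isCompact h.convex h.isCompact_hull0 h.oracle (Nat.zero_le T) h.T_pos h.measurable_grad
    aemeasurable_dirac (hae (h.regular.isStep_iteration_zero h.oracle.measurable hcur))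
    (hae ⟨by obtain ⟨c, hc⟩ := h.nonempty; exact ⟨c, hc, by simp [State.cur]⟩, rfl⟩) ?_
  · rw [zero_add, zero_add] at this
    exact this
  · rw [lintegral_dirac, gradOnHull, Set.indicator_of_mem hcur]
    refine (h.regular.lintegral_iteration_zero_le h.oracle.measurable h.M₀_pos hcur).trans
      (le_of_eq ?_)
    rw [errorBound, Nat.cast_zero, zero_mul, add_zero, add_zero,
      Real.sq_sqrt (by positivity)]

lemma runInvariant_succ {t : ℕ} (ht : t + 1 ≤ T) :
    RunInvariant (gradOnHull O C) C lmo T (t + 1) (M₀ + t * (M * cost))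
      (errorBound ((1 / (M₀ : ℝ)) * ((1 + B) ^ 2 * G ^ 2))
        ((1 / (M : ℝ)) * ((Lbar B G L + τ) * (1 / (T : ℝ) * diameter C)) ^ 2)
        (τ * (1 / (T : ℝ) * diameter C)) t)
      (runLaw O hv cost lmo T M₀ M (t + 1)) := by
  have hD : 0 ≤ diameter C := Metric.diam_nonneg
  have hτ := h.nonneg
  have hβ : 0 ≤ τ * (1 / (T : ℝ) * diameter C) := by positivity
  induction t with
  | zero =>
    have := h.runInvariant_one (cost := cost)
    simpa [errorBound] using this
  | succ t ih =>
    have hinv := ih (by omega)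
    have hprob := hinv.isProbability
    have hgood : ∀ᵐ s ∂runLaw O hv cost lmo T M₀ M (t + 1),
        s ∈ StochObjective.goodStates (hull0 C) (1 / (T : ℝ) * diameter C) :=
      hinv.reachable.mono fun s hs =>
        reachable_subset_goodStates h.isCompact_hull0 h.oracle (by omega) hs
    have hκ : AEMeasurable (iteration O hv cost lmo T M₀ M (t + 1))
        (runLaw O hv cost lmo T M₀ M (t + 1)) :=
      h.approx.aemeasurable_iteration h.regular h.isCompact_hull0.measurableSet
        h.oracle.measurable t.succ_ne_zero hgood
    have key := RunInvariant.bind (t := t + 1) (T := T) (m := M * cost)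
      (n := M₀ + t * (M * cost)) (φ := gradOnHull O C)
      (q := errorBound ((1 / (M₀ : ℝ)) * ((1 + B) ^ 2 * G ^ 2))
        ((1 / (M : ℝ)) * ((Lbar B G L + τ) * (1 / (T : ℝ) * diameter C)) ^ 2)
        (τ * (1 / (T : ℝ) * diameter C)) (t + 1))
      h.isCompact h.convex h.isCompact_hull0 h.oracle (by omega) h.T_pos h.measurable_grad hκ
      (hgood.mono fun s hs => h.approx.isStep_iteration h.regular h.oracle.measurable
        t.succ_ne_zero h.nonneg hs)
      (hinv.reachable.mono fun s hs => ⟨hs.2.1, hs.2.2.2⟩) ?_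
    · have hn : M₀ + (t + 1) * (M * cost) = M₀ + t * (M * cost) + M * cost := by ring
      rw [hn]
      exact key
    · have hle : ∀ᵐ s ∂runLaw O hv cost lmo T M₀ M (t + 1),
          ∫⁻ s' : State d, ENNReal.ofReal (‖s'.grad - gradOnHull O C s.cur‖ ^ 2)
            ∂iteration O hv cost lmo T M₀ M (t + 1) s
          ≤ ENNReal.ofReal ((‖s.grad - gradOnHull O C s.prev‖ + τ * (1 / (T : ℝ) * diameter C)) ^ 2
            + (1 / (M : ℝ)) * ((Lbar B G L + τ) * (1 / (T : ℝ) * diameter C)) ^ 2) := by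
        filter_upwards [hgood] with s hs
        have := h.approx.lintegral_iteration_le h.regular h.oracle.measurable (T := T) (M₀ := M₀)
          (cost := cost) t.succ_ne_zero h.nonneg h.M_pos hs
        rw [gradOnHull, Set.indicator_of_mem hs.2.1, Set.indicator_of_mem hs.1]
        exact this
      refine (lintegral_mono_ae hle).trans ((lintegral_shifted_error_le hinv h.measurable_grad
        (errorBound_nonneg hβ t) hβ (by positivity)).trans (ENNReal.ofReal_le_ofReal ?_))
      exact errorBound_succ (by positivity) (by positivity) hβ t

omit [SigmaFinite O.base] in
lemma abs_objective_le {x : Space d} (hx : x ∈ hull0 C) : |O.objective x| ≤ B := by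
  have := h.regular.isProbability x hx
  have h1 := norm_integral_le_of_norm_le_const (μ := O.sampleLaw x) (f := O.val x) (C := B)
    (Filter.Eventually.of_forall fun z => h.regular.bounded.val_le x hx z)
  simpa [StochObjective.objective] using h1

/-- Recursion for the expected objective along the run. -/
lemma gap_le {xs : Space d} (hxs : xs ∈ C) (t : ℕ) (ht : t ≤ T) :
    O.objective xs - ∫ s : State d, O.objective s.cur ∂runLaw O hv cost lmo T M₀ M t
      ≤ (1 - 1 / (T : ℝ)) ^ t * O.objective xs
        + t * (1 / (T : ℝ) * diameter C * errorBound ((1 / (M₀ : ℝ)) * ((1 + B) ^ 2 * G ^ 2))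
        ((1 / (M : ℝ)) * ((Lbar B G L + τ) * (1 / (T : ℝ) * diameter C)) ^ 2)
        (τ * (1 / (T : ℝ) * diameter C)) (T - 1)
          + Lbar B G L / 2 * (1 / (T : ℝ) * diameter C) ^ 2) := by
  have hD : 0 ≤ diameter C := Metric.diam_nonneg
  have hτ := h.nonneg
  have hβ : 0 ≤ τ * (1 / (T : ℝ) * diameter C) := by positivity
  have hFm := StochObjective.measurable_objective h.regular.measurable_val h.regular.measurable_dens
  have hbox := hull0_subset_box h.nonempty h.subset_box
  have hT1 : 1 / (T : ℝ) ≤ 1 := by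
    rw [div_le_one (by exact_mod_cast h.T_pos)]
    exact_mod_cast h.T_pos
  set E := errorBound ((1 / (M₀ : ℝ)) * ((1 + B) ^ 2 * G ^ 2))
        ((1 / (M : ℝ)) * ((Lbar B G L + τ) * (1 / (T : ℝ) * diameter C)) ^ 2)
        (τ * (1 / (T : ℝ) * diameter C)) (T - 1) with hE
  induction t with
  | zero =>
    have h0 : ∫ s : State d, O.objective s.cur ∂runLaw O hv cost lmo T M₀ M 0 = O.objective 0 := by
      rw [runLaw, integral_dirac]
      rfl
    rw [h0]
    have := h.zero_le
    simp only [pow_zero, Nat.cast_zero]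
    linarith
  | succ t ih =>
    have hinv := h.runInvariant_succ (cost := cost) ht
    have hprog := hinv.integral_progress h.smoothOn.gradOnHull (Lbar_nonneg _ _ _)
      h.isCompact_hull0 hbox h.regular.interior_nonempty h.monotone h.drSubmodular h.oracle ht hxs
      hFm h.measurable_grad (fun x hx => h.abs_objective_le hx) (errorBound_nonneg hβ t)
    have hq : errorBound ((1 / (M₀ : ℝ)) * ((1 + B) ^ 2 * G ^ 2))
        ((1 / (M : ℝ)) * ((Lbar B G L + τ) * (1 / (T : ℝ) * diameter C)) ^ 2)
        (τ * (1 / (T : ℝ) * diameter C)) t ≤ E := errorBound_mono (by positivity) hβ (by omega)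
    have hprev : ∫ s : State d, O.objective s.prev ∂runLaw O hv cost lmo T M₀ M (t + 1)
        = ∫ s : State d, O.objective s.cur ∂runLaw O hv cost lmo T M₀ M t := by
      rcases Nat.eq_zero_or_pos t with rfl | hpos
      · refine integral_prev_bind (T := T) (lmo := lmo) aemeasurable_dirac ?_ hFm
        rw [runLaw, ae_dirac_eq]
        exact ⟨M₀, h.regular.isStep_iteration_zero h.oracle.measurable zero_mem_hull0⟩
      · obtain ⟨k, rfl⟩ : ∃ k, t = k + 1 := ⟨t - 1, by omega⟩
        have hinv' := h.runInvariant_succ (cost := cost) (t := k) (by omega)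
        have hgood : ∀ᵐ s ∂runLaw O hv cost lmo T M₀ M (k + 1),
            s ∈ StochObjective.goodStates (hull0 C) (1 / (T : ℝ) * diameter C) :=
          hinv'.reachable.mono fun s hs =>
            reachable_subset_goodStates h.isCompact_hull0 h.oracle (by omega) hs
        refine integral_prev_bind (T := T) (lmo := lmo)
          (h.approx.aemeasurable_iteration h.regular h.isCompact_hull0.measurableSet
            h.oracle.measurable k.succ_ne_zero hgood) ?_ hFm
        exact hgood.mono fun s hs => ⟨M * cost, h.approx.isStep_iteration h.regular
          h.oracle.measurable k.succ_ne_zero h.nonneg hs⟩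
    rw [hprev] at hprog
    have ih' := mul_le_mul_of_nonneg_left (ih (by omega)) (sub_nonneg.2 hT1)
    have hq' := mul_le_mul_of_nonneg_left hq (show 0 ≤ 1 / (T : ℝ) * diameter C by positivity)
    set c := 1 / (T : ℝ) * diameter C * E + Lbar B G L / 2 * (1 / (T : ℝ) * diameter C) ^ 2 with hc
    have hc0 : 0 ≤ c := by
      have := errorBound_nonneg (V₀ := (1 / (M₀ : ℝ)) * ((1 + B) ^ 2 * G ^ 2))
        (V := (1 / (M : ℝ)) * ((Lbar B G L + τ) * (1 / (T : ℝ) * diameter C)) ^ 2) hβ (T - 1)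
      have := Lbar_nonneg B G L
      positivity
    have hT0 : 0 ≤ 1 / (T : ℝ) := by positivity
    have hc1 : (1 - 1 / (T : ℝ)) * (t * c) ≤ t * c := by
      have : 0 ≤ (t : ℝ) * c := by positivity
      nlinarith
    rw [pow_succ]
    push_cast
    linarith

end RunSetting

end Run

/-! ### Finite differences -/

lemma norm_central_diff_sub_le {E F : Type*} [NormedAddCommGroup E] [NormedSpace ℝ E]
    [NormedAddCommGroup F] [NormedSpace ℝ F] {f : E → F} {f' : E → E →L[ℝ] F} {x u : E} {δ r c : ℝ}
    (hδ : 0 < δ) (hur : δ * ‖u‖ < r) (hf : ∀ y ∈ Metric.ball x r, HasFDerivAt f (f' y) y)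
    (hc : 0 ≤ c) (hlip : ∀ y ∈ Metric.ball x r, ‖f' y - f' x‖ ≤ c * ‖y - x‖) :
    ‖(1 / (2 * δ)) • (f (x + δ • u) - f (x - δ • u)) - f' x u‖ ≤ c * (δ * ‖u‖) * ‖u‖ := by
  have hsub : ∀ y ∈ Metric.closedBall x (δ * ‖u‖), y ∈ Metric.ball x r := fun y hy =>
    (Metric.mem_closedBall.1 hy).trans_lt hur
  have hn : ‖δ • u‖ = δ * ‖u‖ := by rw [norm_smul, Real.norm_of_nonneg hδ.le]
  have h1 : x + δ • u ∈ Metric.closedBall x (δ * ‖u‖) := by simp [hn]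
  have h2 : x - δ • u ∈ Metric.closedBall x (δ * ‖u‖) := by
    rw [Metric.mem_closedBall, dist_eq_norm, sub_sub_cancel_left, norm_neg, hn]
  have key := (convex_closedBall x (δ * ‖u‖)).norm_image_sub_le_of_norm_hasFDerivWithin_le'
    (f := f) (f' := f') (φ := f' x) (C := c * (δ * ‖u‖))
    (fun y hy => (hf y (hsub y hy)).hasFDerivWithinAt)
    (fun y hy => (hlip y (hsub y hy)).trans (mul_le_mul_of_nonneg_left
      (by rw [← dist_eq_norm]; exact hy) hc)) h2 h1
  have hdiff : x + δ • u - (x - δ • u) = (2 * δ) • u := by module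
  rw [hdiff, map_smul, norm_smul, Real.norm_of_nonneg (by positivity)] at key
  have heq : (1 / (2 * δ)) • (f (x + δ • u) - f (x - δ • u)) - f' x u
      = (1 / (2 * δ)) • (f (x + δ • u) - f (x - δ • u) - (2 * δ) • f' x u) := by
    rw [smul_sub (1 / (2 * δ)) (f (x + δ • u) - f (x - δ • u)) ((2 * δ) • f' x u), smul_smul,
      one_div_mul_cancel (by positivity), one_smul]
  rw [heq, norm_smul, Real.norm_of_nonneg (by positivity)]
  calc _ ≤ 1 / (2 * δ) * (c * (δ * ‖u‖) * (2 * δ * ‖u‖)) :=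
        mul_le_mul_of_nonneg_left key (by positivity)
    _ = _ := by field_simp

namespace StochObjective

variable {d : ℕ} {Z : Type*} [MeasurableSpace Z] {O : StochObjective d Z} {K : Set (Space d)}
  {B G L R : ℝ}

lemma approxHessVec_exact (h : O.RegularOn K B G L) {τ : ℝ} (hτ : 0 ≤ τ) :
    O.ApproxHessVec K O.hessVec R τ := by
  refine ⟨?_, fun x _ z u _ => ?_⟩
  · have h1 : Measurable fun p : (K × Z) × Space d => O.hessVec p.1.1 p.1.2 p.2 :=
      measurable_hessVec h.convex h.interior_nonempty h.twiceDiff h.measurable_val h.measurable_dens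
    have h2 : Measurable fun p : (K × Z) × Metric.closedBall (0 : Space d) R =>
        (p.1, (p.2 : Space d)) :=
      measurable_fst.prodMk (measurable_subtype_coe.comp measurable_snd)
    have h3 := h1.comp h2
    exact h3
  · rw [sub_self, norm_zero]
    positivity

/-- A displaced point `y + s u` of the `r`-neighbourhood, for `|s| R < r`. -/
lemma add_smul_mem_thickening {r s : ℝ} (hs : |s| * R < r) {y u : Space d} (hy : y ∈ K)
    (hu : ‖u‖ ≤ R) : y + s • u ∈ Metric.thickening r K := by
  refine Metric.mem_thickening_iff.2 ⟨y, hy, ?_⟩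
  rw [dist_eq_norm, add_sub_cancel_left, norm_smul, Real.norm_eq_abs]
  exact (mul_le_mul_of_nonneg_left hu (abs_nonneg _)).trans_lt hs

lemma measurable_displaced {r s : ℝ} (hs : |s| * R < r) {g : Space d → Z → Space d}
    (hg : Measurable fun p : Metric.thickening r K × Z => g p.1 p.2) :
    Measurable fun p : (K × Z) × Metric.closedBall (0 : Space d) R =>
      g (p.1.1 + s • (p.2 : Space d)) p.1.2 := by
  have h1 : Measurable fun p : (K × Z) × Metric.closedBall (0 : Space d) R =>
      (p.1.1 : Space d) + s • (p.2 : Space d) :=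
    (measurable_subtype_coe.comp measurable_fst.fst).add
      ((measurable_subtype_coe.comp measurable_snd).const_smul s)
  have h2 : Measurable fun p : (K × Z) × Metric.closedBall (0 : Space d) R =>
      (⟨p.1.1 + s • (p.2 : Space d), add_smul_mem_thickening hs p.1.1.2
        (mem_closedBall_zero_iff.1 p.2.2)⟩ : Metric.thickening r K) := Measurable.subtype_mk h1
  have h3 : Measurable fun p : (K × Z) × Metric.closedBall (0 : Space d) R => p.1.2 :=
    measurable_fst.snd
  have h4 := hg.comp (h2.prodMk h3)
  exact h4

lemma approxHessVec_diff (h : O.RegularOn K B G L) {r L₂ δ τ : ℝ} (hr : 0 < r) (hδ : 0 < δ)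
    (hdiff : O.TwiceDiffOn (Metric.thickening r K))
    (hlip : O.HessianLipschitzOn (Metric.thickening r K) L₂) (hδR : δ * R < r)
    (hτ : (1 + B) * (max L₂ 0) * δ * R ≤ τ) :
    O.ApproxHessVec K (O.hessVecDiff δ) R τ := by
  have hsub : K ⊆ Metric.thickening r K := Metric.self_subset_thickening hr K
  have hconv : Convex ℝ (Metric.thickening r K) := h.convex.thickening r
  have hint : (interior (Metric.thickening r K)).Nonempty :=
    h.interior_nonempty.mono (interior_mono hsub)
  have hs1 : |δ| * R < r := by rwa [abs_of_pos hδ]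
  have hs2 : |-δ| * R < r := by rwa [abs_neg]
  obtain ⟨hB, -, -⟩ := h.nonneg
  refine ⟨?_, fun x hx z u hu => ?_⟩
  · have hgv := measurable_gradVal hconv hint hdiff h.measurable_val
    have hsc := measurable_score hconv hint hdiff h.measurable_dens
    have g1 := measurable_displaced hs1 hgv
    have g2 := measurable_displaced hs2 hgv
    have s1 := measurable_displaced hs1 hsc
    have s2 := measurable_displaced hs2 hsc
    have f1 : Measurable fun p : (K × Z) × Space d => O.firstOrderPart p.1.1 p.1.2 p.2 :=
      measurable_firstOrderPart h.convex h.interior_nonempty h.twiceDiff h.measurable_val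
        h.measurable_dens
    have f2 : Measurable fun p : (K × Z) × Metric.closedBall (0 : Space d) R =>
        (p.1, (p.2 : Space d)) :=
      measurable_fst.prodMk (measurable_subtype_coe.comp measurable_snd)
    have f3 := f1.comp f2
    have v1 : Measurable fun p : K × Z => O.val p.1 p.2 := measurable_val_subtype h.measurable_val
    have v2 : Measurable fun p : (K × Z) × Metric.closedBall (0 : Space d) R => p.1 :=
      measurable_fst
    have v3 := v1.comp v2
    have key := (f3.add ((g1.sub g2).const_smul (1 / (2 * δ)))).add
      (v3.smul ((s1.sub s2).const_smul (1 / (2 * δ))))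
    refine (congrArg Measurable (funext fun p => ?_)).mp key
    simp only [hessVecDiff, Pi.add_apply, Pi.smul_apply', Pi.smul_apply, Pi.sub_apply,
      Function.comp_apply, neg_smul, ← sub_eq_add_neg]
  · have hball : ∀ y ∈ Metric.ball x r, y ∈ Metric.thickening r K := fun y hy =>
      Metric.mem_thickening_iff.2 ⟨x, hx, hy⟩
    have hur : δ * ‖u‖ < r := (mul_le_mul_of_nonneg_left hu hδ.le).trans_lt hδR
    have e1 := norm_central_diff_sub_le (f := fun y => O.gradVal y z)
      (f' := fun y => O.hessVal y z) (c := max L₂ 0) hδ hur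
      (fun y hy => hasFDerivAt_gradient (hdiff.val y (hball y hy) z)) (le_max_right _ _)
      (fun y hy => (hlip.val y (hball y hy) x (hsub hx) z).trans
        (mul_le_mul_of_nonneg_right (le_max_left _ _) (norm_nonneg _)))
    have e2 := norm_central_diff_sub_le (f := fun y => O.score y z)
      (f' := fun y => O.hessLog y z) (c := max L₂ 0) hδ hur
      (fun y hy => hasFDerivAt_gradient (hdiff.log (hball y hy) z)) (le_max_right _ _)
      (fun y hy => (hlip.log y (hball y hy) x (hsub hx) z).trans
        (mul_le_mul_of_nonneg_right (le_max_left _ _) (norm_nonneg _)))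
    have hsplit : O.hessVecDiff δ x z u - O.hessVec x z u
        = ((1 / (2 * δ)) • (O.gradVal (x + δ • u) z - O.gradVal (x - δ • u) z) - O.hessVal x z u)
          + O.val x z • ((1 / (2 * δ)) • (O.score (x + δ • u) z - O.score (x - δ • u) z)
            - O.hessLog x z u) := by
      rw [hessVecDiff, hessVec]
      module
    rw [hsplit]
    refine (norm_add_le _ _).trans ?_
    rw [norm_smul]
    have e3 := mul_le_mul (h.bounded.val_le x hx z) e2 (norm_nonneg _) hB
    rw [← Real.norm_eq_abs] at e3
    have hL : 0 ≤ max L₂ 0 := le_max_right _ _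
    have e4 : (1 + B) * max L₂ 0 * δ * ‖u‖ ≤ τ :=
      (mul_le_mul_of_nonneg_left hu (by positivity)).trans hτ
    have e5 := mul_le_mul_of_nonneg_right e4 (norm_nonneg u)
    linarith

end StochObjective

/-! ### The guarantee -/

/-- The size of the initial minibatch makes the initial variance at most `ε² L̄² D²`, up to a
factor `D²` that also covers the case `D = 0`. -/
lemma diam_sq_mul_initial_variance_le {B G L D ε : ℝ} {M₀ : ℕ} (hε : 0 < ε) (hM₀ : 0 < M₀)
    (h : batchConst B G L D / ε ^ 2 ≤ M₀) :
    D ^ 2 * ((1 / (M₀ : ℝ)) * ((1 + B) ^ 2 * G ^ 2)) ≤ (ε * Lbar B G L * D ^ 2) ^ 2 := by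
  have hM : (0 : ℝ) < M₀ := by exact_mod_cast hM₀
  by_cases hD : D = 0
  · subst hD
    simp
  by_cases hL : Lbar B G L = 0
  · have hG : G = 0 := by
      have h1 := Lbar_sq B G L
      rw [hL] at h1
      have h2 : 0 ≤ 4 * B ^ 2 * G ^ 4 := by positivity
      have h3 : 0 ≤ 4 * L ^ 2 := by positivity
      have h4 : 0 ≤ 4 * B ^ 2 * L ^ 2 := by positivity
      have h5 : 0 ≤ G ^ 4 := by positivity
      have h6 : G ^ 4 = 0 := by linarith
      exact pow_eq_zero_iff (four_ne_zero) |>.1 h6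
    subst hG
    simp
    positivity
  · have hDpos : 0 < D ^ 2 := by positivity
    have hLpos : 0 < Lbar B G L ^ 2 := by positivity
    rw [batchConst, div_div, div_le_iff₀ (by positivity)] at h
    rw [one_div, ← mul_assoc, mul_comm (D ^ 2), mul_assoc, inv_mul_le_iff₀ hM]
    calc D ^ 2 * ((1 + B) ^ 2 * G ^ 2) ≤ D ^ 2 * (M₀ * (Lbar B G L ^ 2 * D ^ 2 * ε ^ 2)) :=
          mul_le_mul_of_nonneg_left h hDpos.le
      _ = _ := by ring

lemma one_sub_inv_pow_le {T : ℕ} (hT : 0 < T) : (1 - 1 / (T : ℝ)) ^ T ≤ 1 / Real.exp 1 := by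
  have hT' : (0 : ℝ) < T := by exact_mod_cast hT
  have h1 : 1 - 1 / (T : ℝ) ≤ Real.exp (-(1 / (T : ℝ))) := by
    have := Real.add_one_le_exp (-(1 / (T : ℝ)))
    linarith
  have h0 : 0 ≤ 1 - 1 / (T : ℝ) := by
    rw [sub_nonneg, div_le_one hT']
    exact_mod_cast hT
  calc (1 - 1 / (T : ℝ)) ^ T ≤ Real.exp (-(1 / (T : ℝ))) ^ T := pow_le_pow_left₀ h0 h1 T
    _ = 1 / Real.exp 1 := by
      rw [← Real.exp_nat_mul, mul_neg, mul_one_div_cancel hT'.ne', Real.exp_neg, one_div]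

/-- Total error of a run: first-order errors plus the curvature term. -/
lemma total_error_le {B G L D ε : ℝ} {T M₀ M : ℕ} (hε : 0 < ε) (hT : (T : ℝ) = 1 / ε)
    (hTpos : 0 < T) (hM₀ : 0 < M₀) (h₀ : batchConst B G L D / ε ^ 2 ≤ M₀) (hM : 1 / ε ≤ M) :
    (T : ℝ) * (1 / (T : ℝ) * D * errorBound ((1 / (M₀ : ℝ)) * ((1 + B) ^ 2 * G ^ 2))
        ((1 / (M : ℝ)) * ((Lbar B G L + Lbar B G L * ε / 12) * (1 / (T : ℝ) * D)) ^ 2)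
        (Lbar B G L * ε / 12 * (1 / (T : ℝ) * D)) (T - 1)
          + Lbar B G L / 2 * (1 / (T : ℝ) * D) ^ 2) ≤ 2 * Lbar B G L * ε * D ^ 2 := by
  have hLb := Lbar_nonneg B G L
  have hTi : 1 / (T : ℝ) = ε := by rw [hT, one_div_one_div]
  have hTε : (T : ℝ) * ε = 1 := by rw [hT, one_div_mul_cancel hε.ne']
  have hε1 : ε ≤ 1 := by
    have : (1 : ℝ) ≤ T := by exact_mod_cast hTpos
    nlinarith
  have hTs : ((T - 1 : ℕ) : ℝ) = T - 1 := by
    rw [Nat.cast_sub hTpos, Nat.cast_one]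
  have hMi : 1 / (M : ℝ) ≤ ε := by
    rw [one_div_le (lt_of_lt_of_le (by positivity) hM) hε]
    exact hM
  rw [hTi, errorBound, hTs]
  set A := ε * Lbar B G L * D ^ 2 with hA
  have hA0 : 0 ≤ A := by positivity
  set V₀ := (1 / (M₀ : ℝ)) * ((1 + B) ^ 2 * G ^ 2) with hV₀
  set V := (1 / (M : ℝ)) * ((Lbar B G L + Lbar B G L * ε / 12) * (ε * D)) ^ 2 with hV
  have h1 : D ^ 2 * V₀ ≤ A ^ 2 := diam_sq_mul_initial_variance_le hε hM₀ h₀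
  have hTε' : ((T : ℝ) - 1) * ε = 1 - ε := by linarith
  have hT1 : 0 ≤ (T : ℝ) - 1 := by
    have : (1 : ℝ) ≤ T := by exact_mod_cast hTpos
    linarith
  have h2 : D ^ 2 * (((T : ℝ) - 1) * V) ≤ A ^ 2 := by
    have e1 : V ≤ ε * ((Lbar B G L + Lbar B G L * ε / 12) * (ε * D)) ^ 2 :=
      mul_le_mul_of_nonneg_right hMi (sq_nonneg _)
    have e2 : (1 - ε) * (1 + ε / 12) ^ 2 ≤ 1 := by nlinarith [mul_nonneg hε.le hε.le]
    calc D ^ 2 * (((T : ℝ) - 1) * V)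
        ≤ D ^ 2 * (((T : ℝ) - 1) * (ε * ((Lbar B G L + Lbar B G L * ε / 12) * (ε * D)) ^ 2)) := by
          gcongr
      _ = (((T : ℝ) - 1) * ε) * (1 + ε / 12) ^ 2 * A ^ 2 := by rw [hA]; ring
      _ = ((1 - ε) * (1 + ε / 12) ^ 2) * A ^ 2 := by rw [hTε']
      _ ≤ 1 * A ^ 2 := mul_le_mul_of_nonneg_right e2 (sq_nonneg _)
      _ = A ^ 2 := one_mul _
  have h3 : D * Real.sqrt (V₀ + ((T : ℝ) - 1) * V) ≤ 17 / 12 * A := by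
    have hVs : 0 ≤ V₀ + ((T : ℝ) - 1) * V := by positivity
    refine le_of_sq_le_sq ?_ (by positivity)
    rw [mul_pow, Real.sq_sqrt hVs]
    nlinarith [sq_nonneg A]
  have h4 : D * (((T : ℝ) - 1) * (Lbar B G L * ε / 12 * (ε * D))) ≤ A / 12 := by
    calc D * (((T : ℝ) - 1) * (Lbar B G L * ε / 12 * (ε * D)))
        = (((T : ℝ) - 1) * ε) * (A / 12) := by rw [hA]; ring
      _ ≤ 1 * (A / 12) := by
        rw [hTε']
        exact mul_le_mul_of_nonneg_right (by linarith) (by positivity)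
      _ = A / 12 := one_mul _
  calc (T : ℝ) * (ε * D * (Real.sqrt (V₀ + ((T : ℝ) - 1) * V)
          + ((T : ℝ) - 1) * (Lbar B G L * ε / 12 * (ε * D))) + Lbar B G L / 2 * (ε * D) ^ 2)
      = (T * ε) * (D * Real.sqrt (V₀ + ((T : ℝ) - 1) * V)
          + D * (((T : ℝ) - 1) * (Lbar B G L * ε / 12 * (ε * D))) + A / 2) := by rw [hA]; ring
    _ ≤ 1 * (17 / 12 * A + A / 12 + A / 2) := by
        rw [hTε]
        linarith
    _ = 2 * Lbar B G L * ε * D ^ 2 := by rw [hA]; ring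

section Guarantee

variable {d : ℕ} {C : Set (Space d)} {lmo : Space d → Space d} {Z : Type*} [MeasurableSpace Z]
  {O : StochObjective d Z} [SigmaFinite O.base] {B G L ε : ℝ} {u : Fin d → ℝ}
  {hv : Space d → Z → Space d → Space d} {T M₀ M cost : ℕ}

lemma RunSetting.succeeds
    (h : RunSetting O C u B G L lmo hv T M₀ M (Lbar B G L * ε / 12)) (hε : 0 < ε)
    (hT : (T : ℝ) = 1 / ε) (h₀ : batchConst B G L (diameter C) / ε ^ 2 ≤ M₀) (hM : 1 / ε ≤ M) :
    Succeeds O.objective C (runLaw O hv cost lmo T M₀ M T) (Lbar B G L) ε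
      (M₀ + (T - 1) * (M * cost)) := by
  obtain ⟨k, rfl⟩ : ∃ k, T = k + 1 := ⟨T - 1, by have := h.T_pos; omega⟩
  have hinv := h.runInvariant_succ (cost := cost) (t := k) le_rfl
  have hprob := hinv.isProbability
  have hFm := StochObjective.measurable_objective h.regular.measurable_val h.regular.measurable_dens
  have hcurC : ∀ᵐ s ∂runLaw O hv cost lmo (k + 1) M₀ M (k + 1), s.cur ∈ C := by
    filter_upwards [hinv.reachable] with s hs
    obtain ⟨c, hc, hcs⟩ := hs.2.1
    have hne : ((k + 1 : ℕ) : ℝ) ≠ 0 := by exact_mod_cast k.succ_ne_zero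
    simp only [div_self hne, one_smul] at hcs
    rwa [← hcs]
  refine ⟨hprob, hcurC, ?_, fun xs hxs => ?_, ?_⟩
  · exact integrable_comp_of_ae_mem hFm (fun x hx => h.abs_objective_le hx) State.measurable_cur
      (hcurC.mono fun s hs => subset_hull0 hs)
  · have hbox := hull0_subset_box h.nonempty h.subset_box
    have hgap := h.gap_le (cost := cost) hxs (k + 1) le_rfl
    have herr := total_error_le (D := diameter C) hε hT h.T_pos h.M₀_pos h₀ hM
    have hxs0 : 0 ≤ O.objective xs :=
      h.zero_le.trans (h.monotone _ (hbox zero_mem_hull0) _ (h.subset_box hxs)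
        fun i => (h.subset_box hxs i).1)
    have hpow := mul_le_mul_of_nonneg_right (one_sub_inv_pow_le h.T_pos) hxs0
    rw [ge_iff_le]
    linarith
  · filter_upwards [hinv.reachable] with s hs
    rw [hs.2.2.2, Nat.add_sub_cancel]

lemma oracle_calls_le {κ : ℝ} (hε : 0 < ε) (hT : (T : ℝ) = 1 / ε) (hTpos : 0 < T) (hcost : 1 ≤ cost)
    (h₀ : (M₀ : ℝ) ≤ κ / ε ^ 2 + 1) (hM : (M : ℝ) ≤ 1 / ε + 1) :
    ((M₀ + (T - 1) * (M * cost) : ℕ) : ℝ) ≤ (κ + cost) / ε ^ 2 := by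
  have hTs : ((T - 1 : ℕ) : ℝ) = T - 1 := by rw [Nat.cast_sub hTpos, Nat.cast_one]
  have hT1 : (1 : ℝ) ≤ T := by exact_mod_cast hTpos
  have hc : (1 : ℝ) ≤ cost := by exact_mod_cast hcost
  have hsq : (κ + cost) / ε ^ 2 = κ / ε ^ 2 + cost * (T : ℝ) ^ 2 := by
    rw [hT]
    field_simp
  rw [← hT] at hM
  push_cast
  rw [hsq, hTs]
  have h1 : ((T : ℝ) - 1) * (M * cost) ≤ ((T : ℝ) - 1) * ((T + 1) * cost) := by
    have : 0 ≤ (T : ℝ) - 1 := by linarith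
    gcongr
  have h2 : ((T : ℝ) - 1) * ((T + 1) * cost) = cost * (T : ℝ) ^ 2 - cost := by ring
  linarith

end Guarantee

end SCGpp

end
theorem mainTheorem1 {d : ℕ} {Z : Type*} [MeasurableSpace Z]
    (O : SCGpp.StochObjective d Z) [SigmaFinite O.base]
    -- the feasible set: a convex body in a box of the nonnegative orthant
    (C : Set (SCGpp.Space d)) (u : Fin d → ℝ)
    (hC_compact : IsCompact C) (hC_convex : Convex ℝ C) (hC_nonempty : C.Nonempty)
    (hC_interior : (interior (SCGpp.hull0 C)).Nonempty) (hC_box : C ⊆ SCGpp.box u)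
    -- the objective
    (hO : O.WellPosedOn (SCGpp.box u))
    (hmono : SCGpp.IsMonotoneOn O.objective (SCGpp.box u))
    (hDR : SCGpp.IsDRSubmodularOn O.objective (SCGpp.box u))
    (hzero : 0 ≤ O.objective 0)
    -- differentiability, boundedness, variance and smoothness
    (B G L : ℝ) (hdiff : O.TwiceDiffOn (SCGpp.hull0 C))
    (hbdd : O.BoundedOn (SCGpp.hull0 C) B G L)
    -- the parameters of the run
    (lmo : SCGpp.Space d → SCGpp.Space d) (hlmo : SCGpp.IsLinearOracle C lmo)
    (ε : ℝ) (hε : 0 < ε) (T : ℕ) (hT : (T : ℝ) = 1 / ε)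
    (M₀ M : ℕ) (hM₀_pos : 0 < M₀)
    (hM₀ : SCGpp.batchConst B G L (SCGpp.diameter C) / ε ^ 2 ≤ M₀) (hM : 1 / ε ≤ M) :
    -- exact Hessian-vector products
    SCGpp.Succeeds O.objective C (SCGpp.runLaw O O.hessVec 1 lmo T M₀ M T)
      (SCGpp.Lbar B G L) ε (M₀ + (T - 1) * M) ∧
    -- Hessian-vector products by finite differences (three gradient calls per sample)
    (∀ r L₂ δ : ℝ, 0 < r →
      O.TwiceDiffOn (Metric.thickening r (SCGpp.hull0 C)) →
      O.HessianLipschitzOn (Metric.thickening r (SCGpp.hull0 C)) L₂ →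
      0 < δ → δ * ε * SCGpp.diameter C < r →
      12 * (1 + B) * L₂ * SCGpp.diameter C * δ ≤ SCGpp.Lbar B G L →
      SCGpp.Succeeds O.objective C (SCGpp.runLaw O (O.hessVecDiff δ) 3 lmo T M₀ M T)
        (SCGpp.Lbar B G L) ε (M₀ + (T - 1) * (M * 3))) ∧
    -- with the least admissible minibatches, these are `O(1/ε²)` oracle calls
    ((M₀ : ℝ) ≤ SCGpp.batchConst B G L (SCGpp.diameter C) / ε ^ 2 + 1 → (M : ℝ) ≤ 1 / ε + 1 →
      ((M₀ + (T - 1) * M : ℕ) : ℝ) ≤ (SCGpp.batchConst B G L (SCGpp.diameter C) + 1) / ε ^ 2 ∧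
      ((M₀ + (T - 1) * (M * 3) : ℕ) : ℝ)
        ≤ (SCGpp.batchConst B G L (SCGpp.diameter C) + 3) / ε ^ 2) := by
  have hbox := SCGpp.hull0_subset_box hC_nonempty hC_box
  have hreg : O.RegularOn (SCGpp.hull0 C) B G L :=
    ⟨SCGpp.convex_hull0, hC_interior, hO.measurable_val, hO.measurable_dens,
      fun x hx => hO.isProbability x (hbox hx), hdiff, hbdd⟩
  have hTpos : 0 < T := by
    have : (0 : ℝ) < T := by rw [hT]; positivity
    exact_mod_cast this
  have hMpos : 0 < M := by
    have : (0 : ℝ) < M := lt_of_lt_of_le (by positivity) hM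
    exact_mod_cast this
  have hTi : 1 / (T : ℝ) = ε := by rw [hT, one_div_one_div]
  have hLb := SCGpp.Lbar_nonneg B G L
  have hD : 0 ≤ SCGpp.diameter C := Metric.diam_nonneg
  have setting : ∀ hv : SCGpp.Space d → Z → SCGpp.Space d → SCGpp.Space d,
      O.ApproxHessVec (SCGpp.hull0 C) hv (1 / (T : ℝ) * SCGpp.diameter C)
        (SCGpp.Lbar B G L * ε / 12) →
      SCGpp.RunSetting O C u B G L lmo hv T M₀ M (SCGpp.Lbar B G L * ε / 12) := fun hv happ =>
    ⟨hC_compact, hC_convex, hC_nonempty, hC_box, fun x hx => hO.integrable x (hbox hx), hmono, hDR,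
      hzero, hreg, hlmo, happ, by positivity, hTpos, hM₀_pos, hMpos⟩
  refine ⟨?_, fun r L₂ δ hr hdiff' hlip hδ hδr hδL => ?_, fun h₀ h₁ => ⟨?_, ?_⟩⟩
  · have hrun := (setting _ (SCGpp.StochObjective.approxHessVec_exact hreg (by positivity))).succeeds
      (cost := 1) hε hT hM₀ hM
    rwa [mul_one] at hrun
  · refine (setting _ (SCGpp.StochObjective.approxHessVec_diff hreg hr hδ hdiff' hlip ?_ ?_)).succeeds
      (cost := 3) hε hT hM₀ hM
    · rw [hTi, ← mul_assoc]
      exact hδr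
    · rw [hTi]
      rcases le_total L₂ 0 with hL | hL
      · rw [max_eq_right hL]
        have : 0 ≤ SCGpp.Lbar B G L * ε / 12 := by positivity
        simpa using this
      · rw [max_eq_left hL]
        have := mul_le_mul_of_nonneg_right hδL hε.le
        linarith
  · have hcalls := SCGpp.oracle_calls_le (cost := 1) hε hT hTpos le_rfl h₀ h₁
    rw [mul_one, Nat.cast_one] at hcalls
    exact hcalls
  · have hcalls := SCGpp.oracle_calls_le (cost := 3) hε hT hTpos (by norm_num) h₀ h₁
    exact_mod_cast hcalls
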